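/- Let $Q$ be a finite quiver (a directed graph with finite vertex set $V$ and finitely many arrows, multiple arrows being allowed) that is acyclic, i.e. has no oriented cycle, and whose underlying undirected graph is connected. The frieze of $Q$ is the family of sequences $(a(v,n))_{n\ge 0}$, $v\in V$, of rational numbers defined by $a(v,0)=1$ and $$a(v,n+1)=\frac{1+\prod_{w\to v}a(w,n+1)\prod_{v\to w}a(w,n)}{a(v,n)},$$ where the products run over all arrows of $Q$ ending at $v$, respectively starting at $v$. Then the sequences of the frieze are either all bounded or all unbounded. Suppose moreover that the frieze is rational, i.e. that each of the sequences $(a(v,n))_{n\ge 0}$ satisfies a linear recursion with constant coefficients. If the sequences are all bounded, then the underlying undirected graph of $Q$ (with multiplicities of edges) is a Dynkin diagram $\mathbb A_n$ ($n\ge 1$), $\mathbb D_n$ ($n\ge 4$), $\mathbb E_6$, $\mathbb E_7$ or $\mathbb E_8$; if they are all unbounded, then it is an extended Dynkin diagram $\widetilde{\mathbb A}_n$ ($n\ge 1$), $\widetilde{\mathbb D}_n$ ($n\ge 4$), $\widetilde{\mathbb E}_6$, $\widetilde{\mathbb E}_7$ or $\widetilde{\mathbb E}_8$. Here $\widetilde{\mathbb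 A}_1$ consists of two vertices joined by two edges, and $\widetilde{\mathbb A}_n$ with $n\ge 2$ is the cycle with $n+1$ vertices. -/

import Mathlib

namespace FriezeDynkin

universe u v

section Quivers

variable (V : Type u) [Quiver.{v} V]

/-- A quiver is acyclic if it has no oriented cycle: every closed path has length zero
(in particular there are no loops). Several arrows between two vertices are allowed. -/
def IsAcyclic : Prop :=
  ∀ (x : V) (p : Quiver.Path x x), p.length = 0

/-- The adjacency relation of the underlying undirected graph (multiplicities forgotten);
it serves to speak of connectedness. -/
def underlyingGraph : SimpleGraph V :=
  SimpleGraph.fromRel (fun x y : V => Nonempty (x ⟶ y))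

/-- The underlying undirected multigraph, given by the number of edges between two vertices. -/
def edgeMult [∀ x y : V, Fintype (x ⟶ y)] (x y : V) : ℕ :=
  Fintype.card (x ⟶ y) + Fintype.card (y ⟶ x)

variable {V}

/-- In a finite acyclic quiver, the relation "there is an arrow from `w` to `x`" is well-founded. -/
theorem IsAcyclic.wellFounded [Finite V] (hV : IsAcyclic V) :
    WellFounded (fun w x : V => Nonempty (w ⟶ x)) := by
  let r : V → V → Prop := fun w x => ∃ p : Quiver.Path w x, p.length ≠ 0
  have : IsTrans V r := ⟨by
    rintro a b c ⟨p, hp⟩ ⟨q, hq⟩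
    exact ⟨p.comp q, by rw [Quiver.Path.length_comp]; omega⟩⟩
  have : Std.Irrefl r := ⟨by
    rintro a ⟨p, hp⟩
    exact hp (hV a p)⟩
  have hr : WellFounded r := Finite.wellFounded_of_trans_of_irrefl r
  refine Subrelation.wf (r := r) ?_ hr
  rintro w x ⟨e⟩
  exact ⟨e.toPath, by simp⟩

variable [Fintype V] [∀ x y : V, Fintype (x ⟶ y)]

/-- From the row `prev = a(·, n)` of a frieze, the next row `a(·, n + 1)`, computed by recursion
along the arrows. The products run over all arrows with target `x`, and over all arrows with
source `x`. -/
noncomputable def nextRow (hV : IsAcyclic V) (prev : V → ℚ) : V → ℚ :=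
  hV.wellFounded.fix fun x next =>
    (1 + (∏ w : V, ∏ e : (w ⟶ x), next w ⟨e⟩) * (∏ w : V, ∏ _e : (x ⟶ w), prev w)) / prev x

/-- The frieze of a finite acyclic quiver: `frieze hV x n` is the `n`-th term `a(x, n)` of the
sequence at the vertex `x`. -/
noncomputable def frieze (hV : IsAcyclic V) (x : V) (n : ℕ) : ℚ :=
  Nat.rec (motive := fun _ => V → ℚ) (fun _ => 1) (fun _ prev => nextRow hV prev) n x

theorem frieze_zero (hV : IsAcyclic V) (x : V) : frieze hV x 0 = 1 := rfl

/-- The defining recursion of the frieze. -/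
theorem frieze_succ (hV : IsAcyclic V) (x : V) (n : ℕ) :
    frieze hV x (n + 1) =
      (1 + (∏ w : V, ∏ _e : (w ⟶ x), frieze hV w (n + 1)) *
        (∏ w : V, ∏ _e : (x ⟶ w), frieze hV w n)) / frieze hV x n := by
  change nextRow hV (fun y => frieze hV y n) x = _
  unfold nextRow
  rw [WellFounded.fix_eq]
  rfl

end Quivers

section Sequences

/-- A sequence is rational if it satisfies a linear recursion with constant (complex)
coefficients. -/
def IsRationalSeq (a : ℕ → ℚ) : Prop :=
  ∃ E : LinearRecurrence ℂ, E.IsSolution (fun n => (a n : ℂ))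

/-- A sequence is bounded. -/
def IsBoundedSeq (a : ℕ → ℚ) : Prop :=
  ∃ C : ℚ, ∀ n, |a n| ≤ C

end Sequences

section Diagrams

/-- The simple graph on `{0, …, k - 1}` whose edges are the `{i, j}` with `r i j`, as a
multigraph given by the number of edges between two vertices. -/
def simpleMult (k : ℕ) (r : ℕ → ℕ → Prop) [∀ i j, Decidable (r i j)] (i j : Fin k) : ℕ :=
  if r i j ∨ r j i then 1 else 0

/-- `A_n`: the path with `n` vertices. -/
def diagramA (n : ℕ) : Fin n → Fin n → ℕ :=
  simpleMult n fun i j => i + 1 = j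

/-- `D_n`: the path `0 — 1 — ⋯ — (n - 2)` and a further vertex `n - 1` joined to `n - 3`. -/
def diagramD (n : ℕ) : Fin n → Fin n → ℕ :=
  simpleMult n fun i j => (i + 1 = j ∧ j + 2 ≤ n) ∨ (i + 3 = n ∧ j + 1 = n)

/-- `E_n`: the path `0 — 1 — ⋯ — (n - 2)` and a further vertex `n - 1` joined to `2`. -/
def diagramE (n : ℕ) : Fin n → Fin n → ℕ :=
  simpleMult n fun i j => (i + 1 = j ∧ j + 2 ≤ n) ∨ (i = 2 ∧ j + 1 = n)

/-- `Ã_n`: the cycle with `n + 1` vertices; for `n = 1` these are two vertices joined by two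
edges. -/
def diagramAext (n : ℕ) (i j : Fin (n + 1)) : ℕ :=
  (if i + 1 = j then 1 else 0) + (if j + 1 = i then 1 else 0)

/-- `D̃_n`: the path `0 — 1 — ⋯ — (n - 2)`, a further vertex `n - 1` joined to `1`, and a further
vertex `n` joined to `n - 3`. -/
def diagramDext (n : ℕ) : Fin (n + 1) → Fin (n + 1) → ℕ :=
  simpleMult (n + 1) fun i j =>
    (i + 1 = j ∧ j + 2 ≤ n) ∨ (i = 1 ∧ j + 1 = n) ∨ (i + 3 = n ∧ j = n)

/-- `Ẽ_6`: the path `0 — 1 — 2 — 3 — 4` and a path `2 — 5 — 6`. -/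
def diagramE6ext : Fin 7 → Fin 7 → ℕ :=
  simpleMult 7 fun i j => (i + 1 = j ∧ j ≤ 4) ∨ (i = 2 ∧ j = 5) ∨ (i = 5 ∧ j = 6)

/-- `Ẽ_7`: the path `0 — 1 — ⋯ — 6` and a further vertex `7` joined to `3`. -/
def diagramE7ext : Fin 8 → Fin 8 → ℕ :=
  simpleMult 8 fun i j => (i + 1 = j ∧ j ≤ 6) ∨ (i = 3 ∧ j = 7)

/-- `Ẽ_8`: the path `0 — 1 — ⋯ — 7` and a further vertex `8` joined to `2`. -/
def diagramE8ext : Fin 9 → Fin 9 → ℕ :=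
  simpleMult 9 fun i j => (i + 1 = j ∧ j ≤ 7) ∨ (i = 2 ∧ j = 8)

/-- Isomorphism of multigraphs given by their numbers of edges. -/
def MultIso {V : Type*} {W : Type*} (m : V → V → ℕ) (m' : W → W → ℕ) : Prop :=
  ∃ e : V ≃ W, ∀ x y, m x y = m' (e x) (e y)

/-- The multigraph `m` is a Dynkin diagram `A_n` (`n ≥ 1`), `D_n` (`n ≥ 4`), `E_6`, `E_7`
or `E_8`. -/
def IsDynkin {V : Type*} (m : V → V → ℕ) : Prop :=
  (∃ n, 1 ≤ n ∧ MultIso m (diagramA n)) ∨ (∃ n, 4 ≤ n ∧ MultIso m (diagramD n)) ∨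
    MultIso m (diagramE 6) ∨ MultIso m (diagramE 7) ∨ MultIso m (diagramE 8)

/-- The multigraph `m` is an extended Dynkin diagram `Ã_n` (`n ≥ 1`), `D̃_n` (`n ≥ 4`), `Ẽ_6`,
`Ẽ_7` or `Ẽ_8`. -/
def IsExtendedDynkin {V : Type*} (m : V → V → ℕ) : Prop :=
  (∃ n, 1 ≤ n ∧ MultIso m (diagramAext n)) ∨ (∃ n, 4 ≤ n ∧ MultIso m (diagramDext n)) ∨
    MultIso m diagramE6ext ∨ MultIso m diagramE7ext ∨ MultIso m diagramE8ext

end Diagrams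

end FriezeDynkin

/-!
Everything rests on one identity. Put `x(v, n) = log a(v, n)` and let `m` be the edge multiplicities.
The frieze relation gives `x(v, n + 1) + x(v, n) = log (1 + P)`, where `log P` is the sum of the `x(w, ·)`
over the neighbours `w` of `v`, each taken at time `n` or `n + 1`. Summing over an interval of times,
the partial sums `ℓ` of `x` therefore satisfy `2 ℓ(v) ≈ ∑ w, m(v, w) ℓ(w)`, with an error made of the terms
`log (1 + P) - log P`, which lie in `(0, log 2]`, and of boundary terms.

The terms of the frieze are positive integers (`frieze_num`): modulo `a(v, n)`, the products `P` at
times `n - 1` and `n` are inverse to each other, and the first one is `-1`. Hence `x ≥ 0`, so a neighbour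
of a vertex with bounded sequence has bounded sequence, which is the first alternative. Since a row
determines the next one, a frieze with infinitely many rows below a common bound is eventually periodic.

* If the frieze is bounded, sum over a period: there are no boundary terms, and `ℓ` is a positive
  function with `∑ w, m(v, w) ℓ(w) < 2 ℓ(v)` (`isDynkin_of_bounded`).
* If it is unbounded, its rows leave every finite set, so the total `S(N)` of all `x(v, n)` with `n < N` grows
  faster than `N`. Rationality bounds `x` by a linear function of `n`, so `S` does not grow exponentially
  and the boundary terms are negligible compared with `S(N)` for suitable `N`
  (`exists_small_increment`). By compactness of the simplex, the functions `ℓ / S` approximate a positive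
  `f` with `∑ w, m(v, w) f(w) = 2 f(v)` (`isExtendedDynkin_of_unbounded`).

It remains to see that such functions exist only on Dynkin, respectively extended Dynkin, diagrams.
A longest path shows that a connected multigraph containing no extended Dynkin diagram is Dynkin
(`isDynkin_of_not_containsExtendedDynkin`). If `m` has a positive subadditive function and contains an
extended Dynkin diagram, pairing with the null root of that diagram forces equality everywhere
(`additive_of_hasSuperadditiveWeight`), so that the function is additive and the inclusion is an isomorphism.
Finally, Dynkin diagrams carry no positive additive function (`IsDynkin.false_of_additive`).
-/

namespace FriezeDynkin

/-! ### Multigraphs without extended Dynkin diagrams -/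

section Classification

variable {V W : Type*}

/-- The multigraph `m'` is a (not necessarily induced) subgraph of `m`: its vertices embed into those
of `m`, and edges are at least as many in `m` as in `m'`. -/
def Contains (m : V → V → ℕ) (m' : W → W → ℕ) : Prop :=
  ∃ φ : W → V, Function.Injective φ ∧ ∀ i j, m' i j ≤ m (φ i) (φ j)

/-- Some extended Dynkin diagram is a subgraph of `m`. -/
def ContainsExtendedDynkin (m : V → V → ℕ) : Prop :=
  (∃ n, 1 ≤ n ∧ Contains m (diagramAext n)) ∨ (∃ n, 4 ≤ n ∧ Contains m (diagramDext n)) ∨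
    Contains m diagramE6ext ∨ Contains m diagramE7ext ∨ Contains m diagramE8ext

/-- The multigraph `m` is connected, in the sense that a nonempty set of vertices closed under taking
neighbours contains all vertices. -/
def IsConnectedMult (m : V → V → ℕ) : Prop :=
  ∀ S : Set V, S.Nonempty → (∀ x ∈ S, ∀ y, 0 < m x y → y ∈ S) → S = Set.univ

/-- The vertices `x 0, …, x k` are distinct and consecutive ones are adjacent: a path of length `k`.
The values of `x` beyond `k` are irrelevant. -/
def IsPathSeq (m : V → V → ℕ) (k : ℕ) (x : ℕ → V) : Prop :=
  (∀ i j, i ≤ k → j ≤ k → x i = x j → i = j) ∧ ∀ i < k, 0 < m (x i) (x (i + 1))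

theorem MultIso.of_bijective {m : V → V → ℕ} {m' : W → W → ℕ} (φ : W → V)
    (hφ : Function.Bijective φ) (h : ∀ i j, m (φ i) (φ j) = m' i j) : MultIso m m' := by
  refine ⟨(Equiv.ofBijective φ hφ).symm, fun x y => ?_⟩
  obtain ⟨i, rfl⟩ := hφ.2 x
  obtain ⟨j, rfl⟩ := hφ.2 y
  rw [h, Equiv.ofBijective_symm_apply_apply, Equiv.ofBijective_symm_apply_apply]

section Paths

variable {m : V → V → ℕ} {k : ℕ} {x : ℕ → V}

theorem IsPathSeq.reverse (hsym : ∀ u v, m u v = m v u) (hx : IsPathSeq m k x) :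
    IsPathSeq m k (fun i => x (k - i)) := by
  refine ⟨fun i j hi hj h => ?_, fun i hi => ?_⟩
  · have := hx.1 _ _ (Nat.sub_le k i) (Nat.sub_le k j) h
    omega
  · have := hx.2 (k - (i + 1)) (by omega)
    rw [hsym]
    rwa [show k - (i + 1) + 1 = k - i by omega] at this

theorem IsPathSeq.shift (hx : IsPathSeq m k x) {a l : ℕ} (h : a + l ≤ k) :
    IsPathSeq m l (fun i => x (a + i)) := by
  refine ⟨fun i j hi hj h' => ?_, fun i hi => ?_⟩
  · have := hx.1 _ _ (by omega) (by omega) h'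
    omega
  · exact hx.2 (a + i) (by omega)

theorem IsPathSeq.cons (hx : IsPathSeq m k x) {y : V} (hy : ∀ i ≤ k, y ≠ x i)
    (h : 0 < m y (x 0)) : IsPathSeq m (k + 1) (fun i => if i = 0 then y else x (i - 1)) := by
  refine ⟨fun i j hi hj h' => ?_, fun i hi => ?_⟩
  · rcases Nat.eq_zero_or_pos i with rfl | hi0 <;> rcases Nat.eq_zero_or_pos j with rfl | hj0
    · rfl
    · simp only [if_pos, if_neg hj0.ne'] at h'
      exact absurd h' (hy _ (by omega))
    · simp only [if_pos, if_neg hi0.ne'] at h'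
      exact absurd h'.symm (hy _ (by omega))
    · simp only [if_neg hi0.ne', if_neg hj0.ne'] at h'
      have := hx.1 _ _ (by omega) (by omega) h'
      omega
  · rcases Nat.eq_zero_or_pos i with rfl | hi0
    · simpa using h
    · simp only [if_neg hi0.ne', Nat.add_eq_zero_iff, one_ne_zero, and_false, if_false]
      have := hx.2 (i - 1) (by omega)
      rwa [show i - 1 + 1 = i + 1 - 1 by omega] at this

theorem exists_maximal_path [Finite V] [Nonempty V] (m : V → V → ℕ) :
    ∃ k x, IsPathSeq m k x ∧ ∀ x', ¬ IsPathSeq m (k + 1) x' := by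
  by_contra! hcon
  have key : ∀ k, ∃ x, IsPathSeq m k x := by
    intro k
    induction k with
    | zero =>
      exact ⟨fun _ => Classical.arbitrary V, fun i j hi hj _ => by omega, fun i hi => by omega⟩
    | succ k ih =>
      obtain ⟨x, hx⟩ := ih
      exact hcon k x hx
  obtain ⟨x, hx⟩ := key (Nat.card V)
  have hinj : Function.Injective (fun i : Fin (Nat.card V + 1) => x i) := fun i j h =>
    Fin.ext (hx.1 _ _ (by omega) (by omega) h)
  have := Nat.card_le_card_of_injective _ hinj
  simp at this

/-- A path of length at least two with adjacent ends closes up to a subgraph `Ã_k`. -/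
theorem contains_cycle (hsym : ∀ u v, m u v = m v u) (hx : IsPathSeq m k x) (hk : 2 ≤ k)
    (hc : 0 < m (x k) (x 0)) : ContainsExtendedDynkin m := by
  refine Or.inl ⟨k, by omega, fun i => x i, fun i j h =>
    Fin.ext (hx.1 _ _ (by omega) (by omega) h), ?_⟩
  have step : ∀ i : Fin (k + 1), 0 < m (x i) (x (i + 1 : Fin (k + 1))) := by
    intro i
    rcases Fin.eq_castSucc_or_eq_last i with ⟨j, rfl⟩ | rfl
    · rw [Fin.coeSucc_eq_succ]
      simpa using hx.2 j j.2
    · simpa using hc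
  intro i j
  unfold diagramAext
  split_ifs with h1 h2 h2
  · exfalso
    have h3 : i + (1 + 1) = i + 0 := by rw [← add_assoc, h1, h2, add_zero]
    have h4 := congrArg Fin.val (add_left_cancel h3)
    have h5 : ((1 : Fin (k + 1)) : ℕ) = 1 := by
      rw [Fin.val_one', Nat.mod_eq_of_lt (by omega)]
    rw [Fin.val_add, h5, Fin.val_zero, Nat.mod_eq_of_lt (by omega)] at h4
    omega
  · subst h1; exact step i
  · subst h2; rw [hsym]; exact step j
  · exact Nat.zero_le _

/-- A double edge is a subgraph `Ã_1`. -/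
theorem contains_of_two_le (hsym : ∀ u v, m u v = m v u) (hloop : ∀ v, m v v = 0) {u v : V}
    (h : 2 ≤ m u v) : ContainsExtendedDynkin m := by
  have huv : u ≠ v := by rintro rfl; rw [hloop] at h; omega
  refine Or.inl ⟨1, le_rfl, ![u, v], ?_, ?_⟩
  · intro i j hij
    fin_cases i <;> fin_cases j <;> simp_all
  · have := hsym u v
    intro i j
    fin_cases i <;> fin_cases j <;> simp [diagramAext] <;> omega

/-- To embed a diagram given by a relation `r`, it suffices to realize each edge in one direction. -/
theorem contains_simpleMult (hsym : ∀ u v, m u v = m v u) {N : ℕ} {r : ℕ → ℕ → Prop}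
    [∀ i j, Decidable (r i j)] (φ : ℕ → V)
    (hinj : ∀ i j, i < j → j < N → φ i ≠ φ j)
    (h : ∀ i j, i < N → j < N → r i j → 0 < m (φ i) (φ j)) : Contains m (simpleMult N r) := by
  refine ⟨fun i => φ i, fun i j hij => ?_, fun i j => ?_⟩
  · rcases lt_trichotomy i j with hlt | rfl | hlt
    · exact absurd hij (hinj i j hlt j.2)
    · rfl
    · exact absurd hij.symm (hinj j i hlt i.2)
  · unfold simpleMult
    split_ifs with h1
    · rcases h1 with h1 | h1
      · exact h _ _ i.2 j.2 h1
      · rw [hsym]; exact h _ _ j.2 i.2 h1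
    · exact Nat.zero_le _

/-- The vertices `x s, …, x (s + p - 1)` of a path, numbered from `0`, followed by `y` and then `z`. All the
branched diagrams are numbered in this way: a long path first, then one or two further vertices. -/
def pathAnd (x : ℕ → V) (s p : ℕ) (y z : V) (i : ℕ) : V :=
  if i < p then x (s + i) else if i = p then y else z

theorem pathAnd_ne (hx : IsPathSeq m k x) {s p : ℕ} {y z : V} (hp : s + p ≤ k + 1)
    (hy : ∀ i ≤ k, y ≠ x i) (hz : ∀ i ≤ k, z ≠ x i) {i j : ℕ} (hij : i < j)
    (hyz : j = p + 1 → y ≠ z) (hj : j ≤ p + 1) : pathAnd x s p y z i ≠ pathAnd x s p y z j := by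
  unfold pathAnd
  split_ifs with h1 h2 h3 h3 <;> first
    | omega
    | skip
  · intro h
    have := hx.1 _ _ (by omega) (by omega) h
    omega
  · exact (hy _ (by omega)).symm
  · exact (hz _ (by omega)).symm
  · exact hyz (by omega)


theorem pathAnd_path {s p : ℕ} {y z : V} {i : ℕ} (hi : i < p) :
    pathAnd x s p y z i = x (s + i) := if_pos hi

theorem pathAnd_fst {s p : ℕ} {y z : V} : pathAnd x s p y z p = y := by simp [pathAnd]

theorem pathAnd_snd {s p : ℕ} {y z : V} : pathAnd x s p y z (p + 1) = z := by simp [pathAnd]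

/-- Without extended Dynkin subgraphs, a path has no chord, as a chord would close a cycle. -/
theorem IsPathSeq.adjacent_of_pos (hsym : ∀ u v, m u v = m v u) (hloop : ∀ v, m v v = 0)
    (hext : ¬ ContainsExtendedDynkin m) (hx : IsPathSeq m k x) {i j : ℕ} (hi : i ≤ k)
    (hj : j ≤ k) (h : 0 < m (x i) (x j)) : i + 1 = j ∨ j + 1 = i := by
  have key : ∀ a b, a ≤ b → b ≤ k → 0 < m (x a) (x b) → a + 1 = b := by
    intro a b hab hb hp
    by_contra hne
    rcases hab.eq_or_lt with rfl | hlt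
    · rw [hloop] at hp; omega
    · refine hext (contains_cycle hsym (hx.shift (a := a) (l := b - a) (by omega)) (by omega) ?_)
      rw [hsym]
      simpa [Nat.add_sub_cancel' hab] using hp
  rcases le_total i j with hij | hij
  · exact Or.inl (key i j hij hj h)
  · exact Or.inr (key j i hij hi (by rwa [hsym]))

/-- Without extended Dynkin subgraphs, a vertex off a path has at most one neighbour on the path. -/
theorem IsPathSeq.attach_unique (hsym : ∀ u v, m u v = m v u)
    (hext : ¬ ContainsExtendedDynkin m) (hx : IsPathSeq m k x) {y : V} (hy : ∀ i ≤ k, y ≠ x i)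
    {i j : ℕ} (hi : i ≤ k) (hj : j ≤ k) (h : 0 < m y (x i)) (h' : 0 < m y (x j)) : i = j := by
  have key : ∀ a b, a < b → b ≤ k → 0 < m y (x a) → 0 < m y (x b) → False := by
    intro a b hab hb ha hb'
    have h1 := (hx.shift (a := a) (l := b - a) (by omega)).cons (y := y)
      (fun i hi => hy _ (by omega)) (by simpa using ha)
    refine hext (contains_cycle hsym h1 (by omega) ?_)
    rw [hsym]
    simpa [Nat.add_sub_cancel' hab.le] using hb'
  rcases lt_trichotomy i j with hlt | rfl | hlt
  · exact (key i j hlt hj h h').elim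
  · rfl
  · exact (key j i hlt hi h' h).elim

/-- Two vertices attached at interior vertices of a path, possibly at the same one, give a `D̃_n`. -/
theorem contains_diagramDext (hsym : ∀ u v, m u v = m v u) (hx : IsPathSeq m k x) {y z : V}
    (hy : ∀ i ≤ k, y ≠ x i) (hz : ∀ i ≤ k, z ≠ x i) (hyz : y ≠ z) {s t : ℕ} (hs : 0 < s)
    (hst : s ≤ t) (ht : t < k) (hys : 0 < m y (x s)) (hzt : 0 < m z (x t)) :
    ContainsExtendedDynkin m := by
  refine Or.inr (Or.inl ⟨t - s + 4, by omega, contains_simpleMult hsym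
    (pathAnd x (s - 1) (t - s + 3) y z) ?_ ?_⟩)
  · intro i j hij hj
    exact pathAnd_ne hx (by omega) hy hz hij (fun _ => hyz) (by omega)
  · rintro i j hi hj (⟨rfl, h⟩ | ⟨rfl, h⟩ | ⟨h, rfl⟩)
    · rw [pathAnd_path (by omega), pathAnd_path (by omega)]
      exact hx.2 _ (by omega)
    · obtain rfl : j = t - s + 3 := by omega
      rw [pathAnd_path (by omega), pathAnd_fst, hsym, Nat.sub_add_cancel hs]
      exact hys
    · rw [pathAnd_snd, pathAnd_path (by omega), hsym, show s - 1 + i = t by omega]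
      exact hzt

/-- A path of two vertices attached at distance at least two from both ends gives `Ẽ_6`. -/
theorem contains_diagramE6ext (hsym : ∀ u v, m u v = m v u) (hx : IsPathSeq m k x) {y z : V}
    (hy : ∀ i ≤ k, y ≠ x i) (hz : ∀ i ≤ k, z ≠ x i) (hyz : y ≠ z) {t : ℕ} (ht : 2 ≤ t)
    (htk : t + 2 ≤ k) (hyt : 0 < m y (x t)) (hzy : 0 < m z y) : ContainsExtendedDynkin m := by
  refine Or.inr (Or.inr (Or.inl (contains_simpleMult hsym (pathAnd x (t - 2) 5 y z) ?_ ?_)))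
  · intro i j hij hj
    exact pathAnd_ne hx (by omega) hy hz hij (fun _ => hyz) (by omega)
  · rintro i j hi hj (⟨rfl, h⟩ | ⟨rfl, rfl⟩ | ⟨rfl, rfl⟩)
    · rw [pathAnd_path (by omega), pathAnd_path (by omega)]
      exact hx.2 _ (by omega)
    · rw [pathAnd_path (by omega), pathAnd_fst, hsym, Nat.sub_add_cancel ht]
      exact hyt
    · rw [pathAnd_snd, pathAnd_fst, hsym]
      exact hzy

/-- A vertex attached at distance at least three from both ends gives `Ẽ_7`. -/
theorem contains_diagramE7ext (hsym : ∀ u v, m u v = m v u) (hx : IsPathSeq m k x) {y : V}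
    (hy : ∀ i ≤ k, y ≠ x i) {t : ℕ} (ht : 3 ≤ t) (htk : t + 3 ≤ k) (hyt : 0 < m y (x t)) :
    ContainsExtendedDynkin m := by
  refine Or.inr (Or.inr (Or.inr (Or.inl
    (contains_simpleMult hsym (pathAnd x (t - 3) 7 y y) ?_ ?_))))
  · intro i j hij hj
    exact pathAnd_ne hx (by omega) hy hy hij (by omega) (by omega)
  · rintro i j hi hj (⟨rfl, h⟩ | ⟨rfl, rfl⟩)
    · rw [pathAnd_path (by omega), pathAnd_path (by omega)]
      exact hx.2 _ (by omega)
    · rw [pathAnd_path (by omega), pathAnd_fst, hsym, Nat.sub_add_cancel ht]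
      exact hyt

/-- A vertex attached at distances at least two and five from the ends gives `Ẽ_8`. -/
theorem contains_diagramE8ext (hsym : ∀ u v, m u v = m v u) (hx : IsPathSeq m k x) {y : V}
    (hy : ∀ i ≤ k, y ≠ x i) {t : ℕ} (ht : 2 ≤ t) (htk : t + 5 ≤ k) (hyt : 0 < m y (x t)) :
    ContainsExtendedDynkin m := by
  refine Or.inr (Or.inr (Or.inr (Or.inr
    (contains_simpleMult hsym (pathAnd x (t - 2) 8 y y) ?_ ?_))))
  · intro i j hij hj
    exact pathAnd_ne hx (by omega) hy hy hij (by omega) (by omega)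
  · rintro i j hi hj (⟨rfl, h⟩ | ⟨rfl, rfl⟩)
    · rw [pathAnd_path (by omega), pathAnd_path (by omega)]
      exact hx.2 _ (by omega)
    · rw [pathAnd_path (by omega), pathAnd_fst, hsym, Nat.sub_add_cancel ht]
      exact hyt

theorem multIso_diagramA (hsym : ∀ u v, m u v = m v u) (hloop : ∀ v, m v v = 0)
    (hext : ¬ ContainsExtendedDynkin m) (hx : IsPathSeq m k x) (hV : ∀ v, ∃ i ≤ k, v = x i) :
    MultIso m (diagramA (k + 1)) := by
  refine MultIso.of_bijective (fun i => x i) ⟨fun i j h =>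
    Fin.ext (hx.1 _ _ (by omega) (by omega) h), fun v => ?_⟩ fun i j => ?_
  · obtain ⟨i, hi, rfl⟩ := hV v
    exact ⟨⟨i, by omega⟩, rfl⟩
  · have hle : m (x i) (x j) < 2 := by
      by_contra h
      exact hext (contains_of_two_le hsym hloop (not_lt.1 h))
    unfold diagramA simpleMult
    split_ifs with h
    · have : 0 < m (x i) (x j) := by
        rcases h with h | h
        · rw [← h]; exact hx.2 _ (by omega)
        · rw [← h, hsym]; exact hx.2 _ (by omega)
      omega
    · by_contra h0
      exact h (hx.adjacent_of_pos hsym hloop hext (by omega) (by omega) (Nat.pos_of_ne_zero h0))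

/-- A path with one further vertex `y` attached at `x t`, and no other vertices, is the diagram described
by `r`. -/
theorem multIso_of_branch (hsym : ∀ u v, m u v = m v u) (hloop : ∀ v, m v v = 0)
    (hext : ¬ ContainsExtendedDynkin m) (hx : IsPathSeq m k x) {y : V} (hy : ∀ i ≤ k, y ≠ x i)
    {t : ℕ} (ht : t ≤ k) (hyt : 0 < m y (x t)) (hV : ∀ v, (∃ i ≤ k, v = x i) ∨ v = y)
    (r : ℕ → ℕ → Prop) [∀ i j, Decidable (r i j)]
    (hr : ∀ i j, i < k + 2 → j < k + 2 →
      (r i j ↔ (i + 1 = j ∧ j ≤ k) ∨ (i = t ∧ j = k + 1))) :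
    MultIso m (simpleMult (k + 2) r) := by
  have hinj : ∀ i j, i < j → j < k + 2 → pathAnd x 0 (k + 1) y y i ≠ pathAnd x 0 (k + 1) y y j :=
    fun i j hij hj => pathAnd_ne hx (by omega) hy hy hij (by omega) (by omega)
  have hpath : ∀ i ≤ k, pathAnd x 0 (k + 1) y y i = x i := fun i hi => by
    rw [pathAnd_path (by omega), zero_add]
  refine MultIso.of_bijective (fun i => pathAnd x 0 (k + 1) y y i)
    ⟨fun i j h => ?_, fun v => ?_⟩ fun i j => ?_
  · rcases lt_trichotomy i j with hlt | rfl | hlt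
    · exact absurd h (hinj i j hlt j.2)
    · rfl
    · exact absurd h.symm (hinj j i hlt i.2)
  · rcases hV v with ⟨i, hi, rfl⟩ | rfl
    · exact ⟨⟨i, by omega⟩, hpath i hi⟩
    · exact ⟨⟨k + 1, by omega⟩, pathAnd_fst⟩
  · have hle : m (pathAnd x 0 (k + 1) y y i) (pathAnd x 0 (k + 1) y y j) < 2 := by
      by_contra h
      exact hext (contains_of_two_le hsym hloop (not_lt.1 h))
    have hpos : 0 < m (pathAnd x 0 (k + 1) y y i) (pathAnd x 0 (k + 1) y y j) ↔
        r i j ∨ r j i := by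
      rw [hr i j i.2 j.2, hr j i j.2 i.2]
      have hi := i.2
      have hj := j.2
      rcases Nat.lt_or_ge i (k + 1) with hi' | hi' <;> rcases Nat.lt_or_ge j (k + 1) with hj' | hj'
      · rw [hpath _ (by omega), hpath _ (by omega)]
        constructor
        · intro h
          have := hx.adjacent_of_pos hsym hloop hext (by omega) (by omega) h
          omega
        · intro h
          rcases (show (i : ℕ) + 1 = j ∨ (j : ℕ) + 1 = i by omega) with h | h
          · rw [← h]; exact hx.2 _ (by omega)
          · rw [← h, hsym]; exact hx.2 _ (by omega)
      · rw [show (j : ℕ) = k + 1 by omega, pathAnd_fst, hpath _ (by omega), hsym]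
        constructor
        · intro h
          have := hx.attach_unique hsym hext hy (by omega) ht h hyt
          omega
        · intro h
          rwa [show (i : ℕ) = t by omega]
      · rw [show (i : ℕ) = k + 1 by omega, pathAnd_fst, hpath _ (by omega)]
        constructor
        · intro h
          have := hx.attach_unique hsym hext hy (by omega) ht h hyt
          omega
        · intro h
          rwa [show (j : ℕ) = t by omega]
      · rw [show (j : ℕ) = k + 1 by omega, show (i : ℕ) = k + 1 by omega, hloop]
        omega
    unfold simpleMult
    split_ifs with h
    · have := hpos.2 h
      omega
    · by_contra h0
      exact h (hpos.1 (Nat.pos_of_ne_zero h0))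

theorem exists_attached (hconn : IsConnectedMult m) {S : Set V} (hne : S.Nonempty)
    (hS : S ≠ Set.univ) : ∃ z, z ∉ S ∧ ∃ v ∈ S, 0 < m z v ∨ 0 < m v z := by
  by_contra! hcon
  refine hS (hconn S hne fun u hu v huv => ?_)
  by_contra hv
  exact absurd huv (not_lt.2 (hcon v hv u hu).2)

/-- A connected loopless multigraph without extended Dynkin subgraphs is Dynkin. On a path of maximal
length, either all vertices lie on the path, or some `y` is attached at an interior vertex; a vertex besides
these would create a `D̃_n`, an `Ẽ_6` or a longer path, and the position of `y` is restricted by `Ẽ_7` and `Ẽ_8`. -/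
theorem isDynkin_of_not_containsExtendedDynkin [Finite V] [Nonempty V]
    (hsym : ∀ u v, m u v = m v u) (hloop : ∀ v, m v v = 0) (hconn : IsConnectedMult m)
    (hext : ¬ ContainsExtendedDynkin m) : IsDynkin m := by
  obtain ⟨k, x, hx, hmax⟩ := exists_maximal_path m
  have hend : ∀ {x : ℕ → V}, IsPathSeq m k x → ∀ {z : V}, (∀ i ≤ k, z ≠ x i) →
      ¬ 0 < m z (x 0) := fun hx z hz h => hmax _ (hx.cons hz h)
  have hinner : ∀ {x : ℕ → V}, IsPathSeq m k x → ∀ {z : V}, (∀ i ≤ k, z ≠ x i) →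
      ∀ {t}, t ≤ k → 0 < m z (x t) → 0 < t ∧ t < k := by
    intro x hx z hz t ht h
    refine ⟨Nat.pos_of_ne_zero ?_, lt_of_le_of_ne ht ?_⟩
    · rintro rfl; exact hend hx hz h
    · rintro rfl
      exact hend (hx.reverse hsym) (fun i hi => hz _ (Nat.sub_le _ _)) (by simpa using h)
  by_cases hall : ∀ v, ∃ i ≤ k, v = x i
  · exact Or.inl ⟨k + 1, by omega, multIso_diagramA hsym hloop hext hx hall⟩
  have hattach : ∃ y, (∀ i ≤ k, y ≠ x i) ∧ ∃ t ≤ k, 0 < m y (x t) := by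
    obtain ⟨y, hy, v, ⟨t, ht, rfl⟩, h⟩ := exists_attached hconn (S := {v | ∃ i ≤ k, v = x i})
      ⟨x 0, 0, Nat.zero_le _, rfl⟩ (by simpa [Set.eq_univ_iff_forall] using hall)
    refine ⟨y, fun i hi h => hy ⟨i, hi, h⟩, t, ht, ?_⟩
    rw [hsym (x t)] at h
    simpa using h
  obtain ⟨y, hy, t₀, ht₀, hyt₀⟩ := hattach
  -- By reversing the path, the branch point may be assumed to lie in the first half.
  obtain ⟨x, hx, hy, t, htk, hyt⟩ : ∃ x, IsPathSeq m k x ∧ (∀ i ≤ k, y ≠ x i) ∧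
      ∃ t, 2 * t ≤ k ∧ 0 < m y (x t) := by
    rcases le_total (2 * t₀) k with h | h
    · exact ⟨x, hx, hy, t₀, h, hyt₀⟩
    · exact ⟨_, hx.reverse hsym, fun i _ => hy _ (Nat.sub_le _ _), k - t₀, by omega,
        by simpa [Nat.sub_sub_self ht₀] using hyt₀⟩
  obtain ⟨ht0, htk'⟩ := hinner hx hy (by omega) hyt
  have hV : ∀ v, (∃ i ≤ k, v = x i) ∨ v = y := by
    by_contra hcon
    obtain ⟨z, hz, v, hv, h⟩ := exists_attached hconn (S := {v | (∃ i ≤ k, v = x i) ∨ v = y})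
      ⟨y, Or.inr rfl⟩ (by simpa [Set.eq_univ_iff_forall] using hcon)
    rw [hsym v z, or_self] at h
    have hzx : ∀ i ≤ k, z ≠ x i := fun i hi h => hz (Or.inl ⟨i, hi, h⟩)
    have hzy : z ≠ y := fun h => hz (Or.inr h)
    rcases hv with ⟨j, hj, rfl⟩ | rfl
    · obtain ⟨hj0, hjk⟩ := hinner hx hzx hj h
      rcases le_total t j with htj | htj
      · exact hext (contains_diagramDext hsym hx hy hzx hzy.symm ht0 htj hjk hyt h)
      · exact hext (contains_diagramDext hsym hx hzx hy hzy hj0 htj htk' h hyt)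
    · rcases Nat.lt_or_ge t 2 with ht2 | ht2
      · -- The branch point is `x 1`: the path `z, y, x 1, x 2, …` is longer.
        obtain rfl : t = 1 := by omega
        have h1 := (hx.shift (a := 1) (l := k - 1) (by omega)).cons (y := v)
          (fun i _ => hy _ (by omega)) hyt
        have h2 := h1.cons (y := z) (fun i hi => by
          split_ifs
          · exact hzy
          · exact hzx _ (by omega)) h
        rw [show k - 1 + 1 + 1 = k + 1 by omega] at h2
        exact hmax _ h2
      · exact hext (contains_diagramE6ext hsym hx hy hzx hzy.symm ht2 (by omega) hyt h)
  rcases (show t = 1 ∨ 3 ≤ t ∨ t = 2 by omega) with rfl | ht | rfl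
  · refine Or.inr (Or.inl ⟨k + 2, by omega, ?_⟩)
    refine multIso_of_branch hsym hloop hext (hx.reverse hsym) (t := k - 1)
      (fun i _ => hy _ (Nat.sub_le _ _)) (by omega)
      (by simpa [Nat.sub_sub_self (show 1 ≤ k by omega)] using hyt) (fun v => ?_) _ ?_
    · rcases hV v with ⟨i, hi, rfl⟩ | rfl
      · exact Or.inl ⟨k - i, Nat.sub_le _ _, by simp [Nat.sub_sub_self hi]⟩
      · exact Or.inr rfl
    · intro i j hi hj
      omega
  · exact absurd (contains_diagramE7ext hsym hx hy ht (by omega) hyt) hext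
  · have hk : k < 7 := by
      by_contra hk
      exact hext (contains_diagramE8ext hsym hx hy le_rfl (by omega) hyt)
    have hiso := multIso_of_branch hsym hloop hext hx hy (by omega) hyt hV
      (fun i j => (i + 1 = j ∧ j + 2 ≤ k + 2) ∨ (i = 2 ∧ j + 1 = k + 2))
      (fun i j hi hj => by omega)
    refine Or.inr (Or.inr ?_)
    obtain rfl | rfl | rfl : k = 4 ∨ k = 5 ∨ k = 6 := by omega
    · exact Or.inl hiso
    · exact Or.inr (Or.inl hiso)
    · exact Or.inr (Or.inr hiso)

end Paths
end Classification
/-! ### Additive and subadditive functions -/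

section Weights

variable {V W : Type*}

theorem sum_simpleMult_le {N : ℕ} {r : ℕ → ℕ → Prop} [∀ i j, Decidable (r i j)] (h : ℕ → ℕ)
    (j : Fin N) (s : Finset ℕ) (hs : ∀ i < N, r i j ∨ r j i → i ∈ s) :
    ∑ i : Fin N, simpleMult N r i j * h i ≤ ∑ i ∈ s, h i := by
  unfold simpleMult
  rw [Fin.sum_univ_eq_sum_range (fun i => (if r i j ∨ r j i then 1 else 0) * h i) N]
  simp only [ite_mul, one_mul, zero_mul]
  rw [← Finset.sum_filter]
  refine Finset.sum_le_sum_of_subset fun i hi => ?_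
  rw [Finset.mem_filter, Finset.mem_range] at hi
  exact hs i hi.1 hi.2

theorem le_sum_simpleMult {N : ℕ} {r : ℕ → ℕ → Prop} [∀ i j, Decidable (r i j)] (h : ℕ → ℕ)
    (j : Fin N) (s : Finset ℕ) (hs : ∀ i ∈ s, i < N ∧ (r i j ∨ r j i)) :
    ∑ i ∈ s, h i ≤ ∑ i : Fin N, simpleMult N r i j * h i := by
  unfold simpleMult
  rw [Fin.sum_univ_eq_sum_range (fun i => (if r i j ∨ r j i then 1 else 0) * h i) N]
  simp only [ite_mul, one_mul, zero_mul]
  rw [← Finset.sum_filter]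
  refine Finset.sum_le_sum_of_subset fun i hi => ?_
  rw [Finset.mem_filter, Finset.mem_range]
  exact hs i hi

/-- There is a positive weight `δ` whose sum over the neighbours of any vertex is at least twice its value
there. On an extended Dynkin diagram the null root is such a weight. -/
def HasSuperadditiveWeight [Fintype W] (m : W → W → ℕ) : Prop :=
  ∃ δ : W → ℕ, (∀ i, 0 < δ i) ∧ ∀ j, 2 * δ j ≤ ∑ i, m i j * δ i

/-- There is a nonnegative weight whose sum over the neighbours of any vertex is at most twice its value
there, with strict inequality somewhere. For a Dynkin diagram, the null root of an extended Dynkin diagram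
with one more vertex restricts to such a weight. -/
def HasSubadditiveWeight [Fintype W] (m : W → W → ℕ) : Prop :=
  ∃ h : W → ℕ, (∀ j, ∑ i, m i j * h i ≤ 2 * h j) ∧ ∃ j, ∑ i, m i j * h i < 2 * h j

theorem hasSuperadditiveWeight_diagramAext (n : ℕ) :
    HasSuperadditiveWeight (diagramAext n) := by
  refine ⟨fun _ => 1, fun _ => one_pos, fun j => ?_⟩
  simp only [diagramAext, mul_one, Finset.sum_add_distrib]
  rw [Finset.sum_ite_eq Finset.univ (j + 1) (fun _ => 1)]
  simp only [← eq_sub_iff_add_eq]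
  simp

theorem hasSuperadditiveWeight_diagramDext {n : ℕ} (hn : 4 ≤ n) :
    HasSuperadditiveWeight (diagramDext n) := by
  let δ : ℕ → ℕ := fun i => if 1 ≤ i ∧ i + 3 ≤ n then 2 else 1
  have one : ∀ {i}, ¬ (1 ≤ i ∧ i + 3 ≤ n) → δ i = 1 := fun h => if_neg h
  have two : ∀ {i}, 1 ≤ i ∧ i + 3 ≤ n → δ i = 2 := fun h => if_pos h
  refine ⟨fun i => δ i, fun i => by dsimp only [δ]; split_ifs <;> omega, fun j => ?_⟩
  obtain ⟨j, hj⟩ := j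
  unfold diagramDext
  have main : ∃ s : Finset ℕ, 2 * δ j ≤ ∑ i ∈ s, δ i ∧ ∀ i ∈ s, i < n + 1 ∧
      (((i + 1 = j ∧ j + 2 ≤ n) ∨ (i = 1 ∧ j + 1 = n) ∨ (i + 3 = n ∧ j = n)) ∨
        ((j + 1 = i ∧ i + 2 ≤ n) ∨ (j = 1 ∧ i + 1 = n) ∨ (j + 3 = n ∧ i = n))) := by
    by_cases h1 : j = 0 ∨ j + 1 = n
    · refine ⟨{1}, ?_, by simp; omega⟩
      rw [one (by omega), Finset.sum_singleton, two (by omega)]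
    by_cases h2 : j + 2 = n ∨ j = n
    · refine ⟨{n - 3}, ?_, by simp; omega⟩
      rw [one (by omega), Finset.sum_singleton, two (by omega)]
    rw [two (by omega)]
    by_cases h3 : n = 4
    · refine ⟨{0, 2, 3, 4}, ?_, ?_⟩
      · subst h3; simp [δ]
      · simp only [Finset.mem_insert, Finset.mem_singleton]; omega
    by_cases h4 : j = 1
    · refine ⟨{0, 2, n - 1}, ?_, ?_⟩
      · rw [Finset.sum_insert (by simp; omega), Finset.sum_pair (by omega), one (by omega),
          two (by omega), one (by omega)]
        omega
      · simp only [Finset.mem_insert, Finset.mem_singleton]; omega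
    by_cases h5 : j + 3 = n
    · refine ⟨{n - 4, n - 2, n}, ?_, ?_⟩
      · rw [Finset.sum_insert (by simp; omega), Finset.sum_pair (by omega), two (by omega),
          one (by omega), one (by omega)]
        omega
      · simp only [Finset.mem_insert, Finset.mem_singleton]; omega
    · refine ⟨{j - 1, j + 1}, ?_, ?_⟩
      · rw [Finset.sum_pair (by omega), two (by omega), two (by omega)]
      · simp only [Finset.mem_insert, Finset.mem_singleton]; omega
  obtain ⟨s, hs, hs'⟩ := main
  exact hs.trans (le_sum_simpleMult δ ⟨j, hj⟩ s hs')

theorem hasSuperadditiveWeight_diagramE6ext : HasSuperadditiveWeight diagramE6ext :=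
  ⟨![1, 2, 3, 2, 1, 2, 1], by decide, by decide⟩

theorem hasSuperadditiveWeight_diagramE7ext : HasSuperadditiveWeight diagramE7ext :=
  ⟨![1, 2, 3, 4, 3, 2, 1, 2], by decide, by decide⟩

theorem hasSuperadditiveWeight_diagramE8ext : HasSuperadditiveWeight diagramE8ext :=
  ⟨![2, 4, 6, 5, 4, 3, 2, 1, 3], by decide, by decide⟩

theorem hasSubadditiveWeight_diagramA {n : ℕ} (hn : 1 ≤ n) :
    HasSubadditiveWeight (diagramA n) := by
  obtain ⟨z, hz⟩ : ∃ z : Fin n, (z : ℕ) = 0 := ⟨⟨0, hn⟩, rfl⟩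
  refine ⟨fun _ => 1, fun j => ?_, z, ?_⟩
  · refine (sum_simpleMult_le (fun _ => 1) j {(j : ℕ) - 1, (j : ℕ) + 1} fun i _ h => ?_).trans ?_
    · simp only [Finset.mem_insert, Finset.mem_singleton]; omega
    · exact (Finset.sum_pair (by omega)).le
  · refine (sum_simpleMult_le (fun _ => 1) z {1} fun i _ h => ?_).trans_lt ?_
    · simp only [Finset.mem_singleton]; omega
    · simp

theorem hasSubadditiveWeight_diagramD {n : ℕ} (hn : 4 ≤ n) :
    HasSubadditiveWeight (diagramD n) := by
  let δ : ℕ → ℕ := fun i => if i + 3 ≤ n then 2 else 1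
  have one : ∀ {i}, ¬ (i + 3 ≤ n) → δ i = 1 := fun h => if_neg h
  have two : ∀ {i}, i + 3 ≤ n → δ i = 2 := fun h => if_pos h
  obtain ⟨z, hz⟩ : ∃ z : Fin n, (z : ℕ) = 0 := ⟨⟨0, by omega⟩, rfl⟩
  refine ⟨fun i => δ i, fun j => ?_, z, ?_⟩
  · obtain ⟨j, hj⟩ := j
    have main : ∃ s : Finset ℕ, ∑ i ∈ s, δ i ≤ 2 * δ j ∧ ∀ i < n,
        (((i + 1 = j ∧ j + 2 ≤ n) ∨ (i + 3 = n ∧ j + 1 = n)) ∨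
          ((j + 1 = i ∧ i + 2 ≤ n) ∨ (j + 3 = n ∧ i + 1 = n))) → i ∈ s := by
      by_cases h1 : j = 0
      · refine ⟨{1}, ?_, by simp; omega⟩
        rw [two (by omega), Finset.sum_singleton, two (by omega)]; omega
      by_cases h2 : n < j + 3
      · refine ⟨{n - 3}, ?_, by simp; omega⟩
        rw [one (by omega), Finset.sum_singleton, two (by omega)]
      rw [two (by omega)]
      by_cases h5 : j + 3 = n
      · refine ⟨{n - 4, n - 2, n - 1}, ?_, ?_⟩
        · rw [Finset.sum_insert (by simp; omega), Finset.sum_pair (by omega), two (by omega),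
            one (by omega), one (by omega)]
          omega
        · simp only [Finset.mem_insert, Finset.mem_singleton]; omega
      · refine ⟨{j - 1, j + 1}, ?_, ?_⟩
        · rw [Finset.sum_pair (by omega), two (by omega), two (by omega)]
        · simp only [Finset.mem_insert, Finset.mem_singleton]; omega
    obtain ⟨s, hs, hs'⟩ := main
    exact (sum_simpleMult_le δ ⟨j, hj⟩ s hs').trans hs
  · refine (sum_simpleMult_le δ z {1} fun i _ h => ?_).trans_lt ?_
    · simp only [Finset.mem_singleton]; omega
    · dsimp only
      rw [Finset.sum_singleton, two (by omega), two (by omega)]; omega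

theorem hasSubadditiveWeight_diagramE6 : HasSubadditiveWeight (diagramE 6) :=
  ⟨![1, 2, 3, 2, 1, 2], by decide, by decide⟩

theorem hasSubadditiveWeight_diagramE7 : HasSubadditiveWeight (diagramE 7) :=
  ⟨![2, 3, 4, 3, 2, 1, 2], by decide, by decide⟩

theorem hasSubadditiveWeight_diagramE8 : HasSubadditiveWeight (diagramE 8) :=
  ⟨![2, 4, 6, 5, 4, 3, 2, 3], by decide, by decide⟩

variable [Fintype V] [Fintype W] {m : V → V → ℕ} {m' : W → W → ℕ} {f : V → ℝ}

/-- A positive subadditive function `f` on `m` is additive along any subgraph `m'` with superadditive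
weight `δ`, and `m'` is then a full subgraph without edges to its complement. Indeed the pairing of `δ` with
the defect `2 f - m' f` is nonpositive, whereas all its terms are nonnegative. -/
theorem additive_of_hasSuperadditiveWeight (hw : HasSuperadditiveWeight m') {φ : W → V}
    (hφ : Function.Injective φ) (hle : ∀ i j, m' i j ≤ m (φ i) (φ j)) (hf : ∀ v, 0 < f v)
    (hadd : ∀ v, ∑ w, (m v w : ℝ) * f w ≤ 2 * f v) :
    (∀ i, ∑ w, (m (φ i) w : ℝ) * f w = 2 * f (φ i)) ∧ (∀ i j, m (φ i) (φ j) = m' i j) ∧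
      ∀ i, ∀ v ∉ Set.range φ, m (φ i) v = 0 := by
  classical
  obtain ⟨δ, hδ, hw⟩ := hw
  have hsplit : ∀ i, ∑ w, (m (φ i) w : ℝ) * f w =
      ∑ j, (m (φ i) (φ j) : ℝ) * f (φ j) +
        ∑ w ∈ (Finset.univ.image φ)ᶜ, (m (φ i) w : ℝ) * f w := by
    intro i
    rw [← Finset.sum_add_sum_compl (Finset.univ.image φ), Finset.sum_image (by
      intro a _ b _ h; exact hφ h)]
  have hterm : ∀ i j, (m' i j : ℝ) * f (φ j) ≤ (m (φ i) (φ j) : ℝ) * f (φ j) := fun i j =>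
    mul_le_mul_of_nonneg_right (by exact_mod_cast hle i j) (hf _).le
  have hsum : ∀ i, ∑ j, (m' i j : ℝ) * f (φ j) ≤ ∑ j, (m (φ i) (φ j) : ℝ) * f (φ j) := fun i =>
    Finset.sum_le_sum fun j _ => hterm i j
  have hrest : ∀ i, 0 ≤ ∑ w ∈ (Finset.univ.image φ)ᶜ, (m (φ i) w : ℝ) * f w := fun i =>
    Finset.sum_nonneg fun w _ => mul_nonneg (Nat.cast_nonneg _) (hf w).le
  have hdef : ∀ i, 0 ≤ (δ i : ℝ) * (2 * f (φ i) - ∑ j, (m' i j : ℝ) * f (φ j)) := fun i =>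
    mul_nonneg (Nat.cast_nonneg _) (by
      have := hadd (φ i)
      rw [hsplit] at this
      linarith [hsum i, hrest i])
  have htotal : ∑ i, (δ i : ℝ) * (2 * f (φ i) - ∑ j, (m' i j : ℝ) * f (φ j)) ≤ 0 := by
    have hswap : ∑ i, (δ i : ℝ) * ∑ j, (m' i j : ℝ) * f (φ j) =
        ∑ j, (∑ i, (m' i j : ℝ) * δ i) * f (φ j) := by
      simp only [Finset.mul_sum, Finset.sum_mul]
      rw [Finset.sum_comm]
      exact Finset.sum_congr rfl fun _ _ => Finset.sum_congr rfl fun _ _ => by ring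
    simp only [mul_sub, Finset.sum_sub_distrib]
    rw [hswap, ← Finset.sum_sub_distrib]
    refine Finset.sum_nonpos fun j _ => ?_
    have h1 : (2 * δ j : ℝ) ≤ ∑ i, (m' i j : ℝ) * δ i := by exact_mod_cast hw j
    have := mul_le_mul_of_nonneg_right h1 (hf (φ j)).le
    linarith
  have hzero : ∀ i, 2 * f (φ i) = ∑ j, (m' i j : ℝ) * f (φ j) := by
    intro i
    have h0 := (Finset.sum_eq_zero_iff_of_nonneg fun i _ => hdef i).1
      (le_antisymm htotal (Finset.sum_nonneg fun i _ => hdef i)) i (Finset.mem_univ i)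
    have hδi : (δ i : ℝ) ≠ 0 := by exact_mod_cast (hδ i).ne'
    have := (mul_eq_zero.1 h0).resolve_left hδi
    linarith
  have hbound : ∀ i, ∑ j, (m (φ i) (φ j) : ℝ) * f (φ j) +
      ∑ w ∈ (Finset.univ.image φ)ᶜ, (m (φ i) w : ℝ) * f w ≤ 2 * f (φ i) := fun i => by
    rw [← hsplit]; exact hadd _
  refine ⟨fun i => ?_, fun i j => ?_, fun i v hv => ?_⟩
  · rw [hsplit]
    linarith [hbound i, hzero i, hsum i, hrest i]
  · have heq : ∑ j, (m' i j : ℝ) * f (φ j) = ∑ j, (m (φ i) (φ j) : ℝ) * f (φ j) := by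
      linarith [hbound i, hzero i, hsum i, hrest i]
    have := (Finset.sum_eq_sum_iff_of_le fun j _ => hterm i j).1 heq j (Finset.mem_univ j)
    exact_mod_cast (mul_right_cancel₀ (hf _).ne' this).symm
  · have heq : ∑ w ∈ (Finset.univ.image φ)ᶜ, (m (φ i) w : ℝ) * f w = 0 := by
      linarith [hbound i, hzero i, hsum i, hrest i]
    have := (Finset.sum_eq_zero_iff_of_nonneg fun w _ =>
      mul_nonneg (Nat.cast_nonneg _) (hf w).le).1 heq v (by simpa using hv)
    exact_mod_cast (mul_eq_zero.1 this).resolve_right (hf v).ne'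

theorem Contains.exists_additive_at [Nonempty W] (hc : Contains m m')
    (hw : HasSuperadditiveWeight m') (hf : ∀ v, 0 < f v)
    (hadd : ∀ v, ∑ w, (m v w : ℝ) * f w ≤ 2 * f v) : ∃ v, ∑ w, (m v w : ℝ) * f w = 2 * f v := by
  obtain ⟨φ, hφ, hle⟩ := hc
  exact ⟨_, (additive_of_hasSuperadditiveWeight hw hφ hle hf hadd).1 (Classical.arbitrary W)⟩

theorem Contains.multIso [Nonempty W] (hconn : IsConnectedMult m) (hc : Contains m m')
    (hw : HasSuperadditiveWeight m') (hf : ∀ v, 0 < f v)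
    (hadd : ∀ v, ∑ w, (m v w : ℝ) * f w ≤ 2 * f v) : MultIso m m' := by
  obtain ⟨φ, hφ, hle⟩ := hc
  obtain ⟨-, h1, h2⟩ := additive_of_hasSuperadditiveWeight hw hφ hle hf hadd
  refine MultIso.of_bijective φ ⟨hφ, Set.range_eq_univ.1 (hconn _ (Set.range_nonempty φ) ?_)⟩ h1
  rintro _ ⟨i, rfl⟩ v hv
  by_contra hr
  exact hv.ne' (h2 i v hr)

/-- Pairing an additive function with a subadditive weight that is strict somewhere gives a contradiction. -/
theorem MultIso.false_of_additive (hiso : MultIso m m') (hw : HasSubadditiveWeight m')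
    (hf : ∀ v, 0 < f v) (hadd : ∀ v, ∑ w, (m v w : ℝ) * f w = 2 * f v) : False := by
  obtain ⟨e, he⟩ := hiso
  obtain ⟨h, hle, j₀, hlt⟩ := hw
  have h1 : ∀ i, ∑ j, (m' i j : ℝ) * f (e.symm j) = 2 * f (e.symm i) := fun i => by
    rw [← hadd, ← Equiv.sum_comp e]
    exact Finset.sum_congr rfl fun w _ => by simp [he]
  have h2 : ∑ i, (h i : ℝ) * (2 * f (e.symm i)) =
      ∑ j, (∑ i, (m' i j : ℝ) * h i) * f (e.symm j) := by
    simp only [← h1, Finset.mul_sum, Finset.sum_mul]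
    rw [Finset.sum_comm]
    exact Finset.sum_congr rfl fun _ _ => Finset.sum_congr rfl fun _ _ => by ring
  have h3 : ∑ j, (∑ i, (m' i j : ℝ) * h i) * f (e.symm j) <
      ∑ j, (2 * h j : ℝ) * f (e.symm j) := by
    refine Finset.sum_lt_sum (fun j _ => ?_) ⟨j₀, Finset.mem_univ _, ?_⟩
    · exact mul_le_mul_of_nonneg_right (by exact_mod_cast hle j) (hf _).le
    · exact mul_lt_mul_of_pos_right (by exact_mod_cast hlt) (hf _)
  rw [← h2] at h3
  refine h3.ne (Finset.sum_congr rfl fun _ _ => by ring)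

theorem IsDynkin.false_of_additive (hm : IsDynkin m) (hf : ∀ v, 0 < f v)
    (hadd : ∀ v, ∑ w, (m v w : ℝ) * f w = 2 * f v) : False := by
  rcases hm with ⟨n, hn, h⟩ | ⟨n, hn, h⟩ | h | h | h
  · exact h.false_of_additive (hasSubadditiveWeight_diagramA hn) hf hadd
  · exact h.false_of_additive (hasSubadditiveWeight_diagramD hn) hf hadd
  · exact h.false_of_additive hasSubadditiveWeight_diagramE6 hf hadd
  · exact h.false_of_additive hasSubadditiveWeight_diagramE7 hf hadd
  · exact h.false_of_additive hasSubadditiveWeight_diagramE8 hf hadd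

theorem isDynkin_of_strictly_subadditive [Nonempty V] (hsym : ∀ u v, m u v = m v u)
    (hloop : ∀ v, m v v = 0) (hconn : IsConnectedMult m) (hf : ∀ v, 0 < f v)
    (hadd : ∀ v, ∑ w, (m v w : ℝ) * f w < 2 * f v) : IsDynkin m := by
  refine isDynkin_of_not_containsExtendedDynkin hsym hloop hconn fun hext => ?_
  have hle := fun v => (hadd v).le
  obtain ⟨v, hv⟩ : ∃ v, ∑ w, (m v w : ℝ) * f w = 2 * f v := by
    rcases hext with ⟨n, -, h⟩ | ⟨n, hn, h⟩ | h | h | h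
    · exact h.exists_additive_at (hasSuperadditiveWeight_diagramAext n) hf hle
    · exact h.exists_additive_at (hasSuperadditiveWeight_diagramDext hn) hf hle
    · exact h.exists_additive_at hasSuperadditiveWeight_diagramE6ext hf hle
    · exact h.exists_additive_at hasSuperadditiveWeight_diagramE7ext hf hle
    · exact h.exists_additive_at hasSuperadditiveWeight_diagramE8ext hf hle
  exact (hadd v).ne hv

theorem isExtendedDynkin_of_additive [Nonempty V] (hsym : ∀ u v, m u v = m v u)
    (hloop : ∀ v, m v v = 0) (hconn : IsConnectedMult m) (hf : ∀ v, 0 < f v)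
    (hadd : ∀ v, ∑ w, (m v w : ℝ) * f w = 2 * f v) : IsExtendedDynkin m := by
  have hle := fun v => (hadd v).le
  have hext : ContainsExtendedDynkin m := by
    by_contra h
    exact (isDynkin_of_not_containsExtendedDynkin hsym hloop hconn h).false_of_additive hf hadd
  rcases hext with ⟨n, hn, h⟩ | ⟨n, hn, h⟩ | h | h | h
  · exact Or.inl ⟨n, hn, h.multIso hconn (hasSuperadditiveWeight_diagramAext n) hf hle⟩
  · exact Or.inr (Or.inl ⟨n, hn, h.multIso hconn (hasSuperadditiveWeight_diagramDext hn) hf hle⟩)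
  · exact Or.inr (Or.inr (Or.inl (h.multIso hconn hasSuperadditiveWeight_diagramE6ext hf hle)))
  · exact Or.inr (Or.inr (Or.inr (Or.inl
      (h.multIso hconn hasSuperadditiveWeight_diagramE7ext hf hle))))
  · exact Or.inr (Or.inr (Or.inr (Or.inr
      (h.multIso hconn hasSuperadditiveWeight_diagramE8ext hf hle))))

end Weights
/-! ### Friezes: integrality, boundedness and periodicity -/

section Friezes

universe u v

variable {V : Type u} [Quiver.{v} V] [∀ x y : V, Fintype (x ⟶ y)]

theorem edgeMult_comm (x y : V) : edgeMult V x y = edgeMult V y x := Nat.add_comm _ _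

theorem edgeMult_self (hV : IsAcyclic V) (x : V) : edgeMult V x x = 0 := by
  have : IsEmpty (x ⟶ x) := ⟨fun e => by simpa using hV x e.toPath⟩
  simp [edgeMult]

theorem isConnectedMult_edgeMult (hconn : (underlyingGraph V).Connected) :
    IsConnectedMult (edgeMult V) := by
  intro S ⟨x, hx⟩ hS
  refine Set.eq_univ_of_forall fun y => ?_
  obtain ⟨p⟩ := hconn.preconnected x y
  induction p with
  | nil => exact hx
  | cons h _ ih =>
    refine ih (hS _ hx _ ?_)
    rw [underlyingGraph, SimpleGraph.fromRel_adj] at h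
    rcases h.2 with h | h
    · exact Nat.add_pos_left (Fintype.card_pos_iff.2 h) _
    · exact Nat.add_pos_right _ (Fintype.card_pos_iff.2 h)

variable [Fintype V]

theorem frieze_pos (hV : IsAcyclic V) (x : V) (n : ℕ) : 0 < frieze hV x n := by
  induction n generalizing x with
  | zero => rw [frieze_zero]; exact one_pos
  | succ n ih =>
    induction x using hV.wellFounded.induction with
    | _ x ihx =>
      rw [frieze_succ]
      refine div_pos (add_pos_of_pos_of_nonneg one_pos (mul_nonneg ?_ ?_)) (ih x)
      · exact Finset.prod_nonneg fun w _ => Finset.prod_nonneg fun e _ => (ihx w ⟨e⟩).le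
      · exact Finset.prod_nonneg fun w _ => Finset.prod_nonneg fun e _ => (ih w).le

theorem frieze_succ_mul (hV : IsAcyclic V) (x : V) (n : ℕ) :
    frieze hV x (n + 1) * frieze hV x n =
      1 + (∏ w, frieze hV w (n + 1) ^ Fintype.card (w ⟶ x)) *
        ∏ w, frieze hV w n ^ Fintype.card (x ⟶ w) := by
  rw [frieze_succ, div_mul_cancel₀ _ (frieze_pos hV x n).ne']
  simp only [Finset.prod_const, Finset.card_univ]

/-- The divisibility behind the integrality of friezes. Here `p`, `c`, `s` are three consecutive rows, and
the hypotheses `hs`, `hp` hold since `c v` is a factor in the products of the frieze relation at each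
neighbour `w` of `v`. -/
theorem dvd_one_add_prod (v : V) (p c s : V → ℤ)
    (h : c v * p v = 1 + (∏ w, c w ^ Fintype.card (w ⟶ v)) * ∏ w, p w ^ Fintype.card (v ⟶ w))
    (hs : ∀ w, Nonempty (w ⟶ v) → s w * c w ≡ 1 [ZMOD c v])
    (hp : ∀ w, Nonempty (v ⟶ w) → c w * p w ≡ 1 [ZMOD c v]) :
    c v ∣ 1 + (∏ w, s w ^ Fintype.card (w ⟶ v)) * ∏ w, c w ^ Fintype.card (v ⟶ w) := by
  set P := (∏ w, c w ^ Fintype.card (w ⟶ v)) * ∏ w, p w ^ Fintype.card (v ⟶ w) with hP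
  set Q := (∏ w, s w ^ Fintype.card (w ⟶ v)) * ∏ w, c w ^ Fintype.card (v ⟶ w) with hQ
  have hprod : ∀ (g : V → ℤ) (k : V → ℕ), (∀ w, k w ≠ 0 → g w ≡ 1 [ZMOD c v]) →
      ∏ w, g w ^ k w ≡ 1 [ZMOD c v] := by
    intro g k hg
    rw [← Finset.prod_const_one (s := (Finset.univ : Finset V))]
    refine Int.ModEq.prod fun w _ => ?_
    by_cases hk : k w = 0
    · rw [hk, pow_zero]
    · simpa using (hg w hk).pow (k w)
  -- Each factor of `Q` is inverse to the corresponding factor of `P`, and `P ≡ -1`.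
  have h1 : Q * P ≡ 1 [ZMOD c v] := by
    have e : Q * P = (∏ w, (s w * c w) ^ Fintype.card (w ⟶ v)) *
        ∏ w, (c w * p w) ^ Fintype.card (v ⟶ w) := by
      simp only [mul_pow, Finset.prod_mul_distrib, hP, hQ]
      ring
    rw [e]
    exact (hprod _ _ fun w hw => hs w (Fintype.card_pos_iff.1 (Nat.pos_of_ne_zero hw))).mul
      (hprod _ _ fun w hw => hp w (Fintype.card_pos_iff.1 (Nat.pos_of_ne_zero hw)))
  have h2 : c v ∣ Q * P - 1 := (Int.modEq_iff_dvd.1 h1.symm)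
  have h3 : 1 + Q = Q * (c v * p v) - (Q * P - 1) := by rw [h]; ring
  rw [h3]
  exact dvd_sub ((dvd_mul_right _ _).mul_left _) h2

/-- The terms of a frieze are integers. -/
theorem frieze_num (hV : IsAcyclic V) (x : V) (n : ℕ) :
    ((frieze hV x n).num : ℚ) = frieze hV x n := by
  induction n using Nat.strong_induction_on generalizing x with
  | _ n ih =>
  cases n with
  | zero => simp [frieze_zero]
  | succ n =>
  have hcur : ∀ x, ((frieze hV x n).num : ℚ) = frieze hV x n := ih n (Nat.lt_succ_self n)
  -- The recursion among numerators, where the relevant terms are known to be integers.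
  have hrec : ∀ (x : V) (l : ℕ), (∀ w, ((frieze hV w l).num : ℚ) = frieze hV w l) →
      (∀ w, Nonempty (w ⟶ x) → ((frieze hV w (l + 1)).num : ℚ) = frieze hV w (l + 1)) →
      (((1 + (∏ w, (frieze hV w (l + 1)).num ^ Fintype.card (w ⟶ x)) *
        ∏ w, (frieze hV w l).num ^ Fintype.card (x ⟶ w) : ℤ)) : ℚ) =
        frieze hV x (l + 1) * frieze hV x l := by
    intro x l h1 h2
    rw [frieze_succ_mul]
    push_cast
    simp only [h1]
    congr 2
    refine Finset.prod_congr rfl fun w _ => ?_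
    by_cases hw : Fintype.card (w ⟶ x) = 0
    · rw [hw, pow_zero, pow_zero]
    · rw [h2 w (Fintype.card_pos_iff.1 (Nat.pos_of_ne_zero hw))]
  -- The predecessors are included in the claim, so that it can be used two arrows away.
  suffices key : ((frieze hV x (n + 1)).num : ℚ) = frieze hV x (n + 1) ∧
      ∀ w, Nonempty (w ⟶ x) → ((frieze hV w (n + 1)).num : ℚ) = frieze hV w (n + 1) from key.1
  induction x using hV.wellFounded.induction with
  | _ x ihx =>
  have hpred : ∀ w, Nonempty (w ⟶ x) →
      ((frieze hV w (n + 1)).num : ℚ) = frieze hV w (n + 1) := fun w hw => (ihx w hw).1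
  refine ⟨?_, hpred⟩
  have hint : ∀ (w : V) (l : ℕ), (∀ w, ((frieze hV w l).num : ℚ) = frieze hV w l) →
      (∀ u, Nonempty (u ⟶ w) → ((frieze hV u (l + 1)).num : ℚ) = frieze hV u (l + 1)) →
      ((frieze hV w (l + 1)).num : ℚ) = frieze hV w (l + 1) →
      (frieze hV w (l + 1)).num * (frieze hV w l).num =
        1 + (∏ u, (frieze hV u (l + 1)).num ^ Fintype.card (u ⟶ w)) *
        ∏ u, (frieze hV u l).num ^ Fintype.card (w ⟶ u) := by
    intro w l h1 h2 h3
    have := hrec w l h1 h2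
    rw [← h1 w, ← h3] at this
    exact_mod_cast this.symm
  have hdvd : (frieze hV x n).num ∣ 1 + (∏ w, (frieze hV w (n + 1)).num ^ Fintype.card (w ⟶ x)) *
        ∏ w, (frieze hV w n).num ^ Fintype.card (x ⟶ w) := by
    cases n with
    | zero => simp [frieze_zero]
    | succ n =>
      have hprev : ∀ x, ((frieze hV x n).num : ℚ) = frieze hV x n := ih n (by omega)
      refine dvd_one_add_prod x (fun w => (frieze hV w n).num) (fun w => (frieze hV w (n + 1)).num)
        (fun w => (frieze hV w (n + 1 + 1)).num)
        (hint x n hprev (fun u _ => hcur u) (hcur x)) (fun w hw => ?_) (fun w hw => ?_)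
      · rw [hint w (n + 1) hcur (ihx w hw).2 (hpred w hw)]
        refine (Int.modEq_iff_dvd.2 ?_).symm
        rw [add_sub_cancel_left]
        exact ((dvd_pow_self _ (Fintype.card_pos_iff.2 hw).ne').trans
          (Finset.dvd_prod_of_mem (fun u => (frieze hV u (n + 1)).num ^ Fintype.card (w ⟶ u))
            (Finset.mem_univ x))).mul_left _
      · rw [hint w n hprev (fun u _ => hcur u) (hcur w)]
        refine (Int.modEq_iff_dvd.2 ?_).symm
        rw [add_sub_cancel_left]
        exact ((dvd_pow_self _ (Fintype.card_pos_iff.2 hw).ne').trans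
          (Finset.dvd_prod_of_mem (fun u => (frieze hV u (n + 1)).num ^ Fintype.card (u ⟶ w))
            (Finset.mem_univ x))).mul_right _
  obtain ⟨q, hq⟩ := hdvd
  have h := hrec x n hcur hpred
  rw [hq, Int.cast_mul, hcur x, mul_comm] at h
  rw [← mul_right_cancel₀ (frieze_pos hV x n).ne' h, Rat.num_intCast]

theorem one_le_frieze (hV : IsAcyclic V) (x : V) (n : ℕ) : 1 ≤ frieze hV x n := by
  rw [← frieze_num]
  exact_mod_cast Rat.num_pos.2 (frieze_pos hV x n)

/-- Each row of a frieze determines the following rows. -/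
theorem frieze_add_eq (hV : IsAcyclic V) {a b : ℕ} (h : ∀ x, frieze hV x a = frieze hV x b)
    (k : ℕ) (x : V) : frieze hV x (a + k) = frieze hV x (b + k) := by
  induction k generalizing x with
  | zero => exact h x
  | succ k ih =>
    change nextRow hV (fun y => frieze hV y (a + k)) x = nextRow hV (fun y => frieze hV y (b + k)) x
    rw [funext ih]

/-- The logarithms of the terms of a frieze. -/
noncomputable def logFrieze (hV : IsAcyclic V) (x : V) (n : ℕ) : ℝ := Real.log (frieze hV x n)

theorem logFrieze_zero (hV : IsAcyclic V) (x : V) : logFrieze hV x 0 = 0 := by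
  simp [logFrieze, frieze_zero]

theorem logFrieze_nonneg (hV : IsAcyclic V) (x : V) (n : ℕ) : 0 ≤ logFrieze hV x n :=
  Real.log_nonneg (by exact_mod_cast one_le_frieze hV x n)

/-- The logarithm of the product in the frieze relation: the sum of the logarithms at the neighbours of
`x`, at time `n + 1` for the arrows ending at `x` and at time `n` for the arrows starting at `x`. -/
noncomputable def logNeighbours (hV : IsAcyclic V) (x : V) (n : ℕ) : ℝ :=
  ∑ w, (Fintype.card (w ⟶ x) : ℝ) * logFrieze hV w (n + 1) +
    ∑ w, (Fintype.card (x ⟶ w) : ℝ) * logFrieze hV w n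

/-- The frieze relation after taking logarithms, from `P < 1 + P ≤ 2 P`. The second inequality needs
`1 ≤ P`, which comes from integrality. -/
theorem logFrieze_add_bounds (hV : IsAcyclic V) (x : V) (n : ℕ) :
    logNeighbours hV x n < logFrieze hV x (n + 1) + logFrieze hV x n ∧
      logFrieze hV x (n + 1) + logFrieze hV x n ≤ logNeighbours hV x n + Real.log 2 := by
  set P : ℝ := (∏ w, (frieze hV w (n + 1) : ℝ) ^ Fintype.card (w ⟶ x)) *
    ∏ w, (frieze hV w n : ℝ) ^ Fintype.card (x ⟶ w) with hP
  have hpos : ∀ w n, (0 : ℝ) < frieze hV w n := fun w n => by exact_mod_cast frieze_pos hV w n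
  have hlogP : Real.log P = logNeighbours hV x n := by
    rw [hP, Real.log_mul, Real.log_prod, Real.log_prod]
    · simp only [Real.log_pow]; rfl
    · exact fun w _ => (pow_pos (hpos _ _) _).ne'
    · exact fun w _ => (pow_pos (hpos _ _) _).ne'
    · exact (Finset.prod_pos fun w _ => pow_pos (hpos _ _) _).ne'
    · exact (Finset.prod_pos fun w _ => pow_pos (hpos _ _) _).ne'
  have hPpos : 0 < P := mul_pos (Finset.prod_pos fun w _ => pow_pos (hpos _ _) _)
    (Finset.prod_pos fun w _ => pow_pos (hpos _ _) _)
  have hlog0 : 0 ≤ Real.log P := by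
    rw [hlogP]
    exact add_nonneg
      (Finset.sum_nonneg fun w _ => mul_nonneg (Nat.cast_nonneg _) (logFrieze_nonneg hV _ _))
      (Finset.sum_nonneg fun w _ => mul_nonneg (Nat.cast_nonneg _) (logFrieze_nonneg hV _ _))
  have hP1 : 1 ≤ P := by
    by_contra h
    exact absurd hlog0 (not_le.2 (Real.log_neg hPpos (not_le.1 h)))
  have hsum : logFrieze hV x (n + 1) + logFrieze hV x n = Real.log (1 + P) := by
    unfold logFrieze
    rw [← Real.log_mul (hpos _ _).ne' (hpos _ _).ne']
    congr 1
    have := frieze_succ_mul hV x n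
    rw [← Rat.cast_mul, this, hP]
    push_cast
    rfl
  rw [hsum, ← hlogP]
  refine ⟨Real.log_lt_log hPpos (by linarith), ?_⟩
  rw [← Real.log_mul hPpos.ne' two_ne_zero]
  exact Real.log_le_log (by linarith) (by linarith)

theorem isBoundedSeq_frieze_iff (hV : IsAcyclic V) (x : V) :
    IsBoundedSeq (frieze hV x) ↔ ∃ B, ∀ n, logFrieze hV x n ≤ B := by
  have hpos : ∀ n, (0 : ℝ) < frieze hV x n := fun n => by exact_mod_cast frieze_pos hV x n
  constructor
  · rintro ⟨C, hC⟩
    refine ⟨Real.log C, fun n => Real.log_le_log (hpos n) ?_⟩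
    exact_mod_cast (le_abs_self _).trans (hC n)
  · rintro ⟨B, hB⟩
    obtain ⟨C, hC⟩ := exists_rat_gt (Real.exp B)
    refine ⟨C, fun n => ?_⟩
    rw [abs_of_pos (frieze_pos hV x n)]
    have h1 : (frieze hV x n : ℝ) ≤ Real.exp B := (Real.log_le_iff_le_exp (hpos n)).1 (hB n)
    exact_mod_cast h1.trans hC.le

theorem isBoundedSeq_of_edge (hV : IsAcyclic V) {x y : V}
    (hx : IsBoundedSeq (frieze hV x)) (hxy : 0 < edgeMult V x y) :
    IsBoundedSeq (frieze hV y) := by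
  rw [isBoundedSeq_frieze_iff] at hx ⊢
  obtain ⟨B, hB⟩ := hx
  have hle : ∀ n, logNeighbours hV x n ≤ B + B := fun n =>
    (logFrieze_add_bounds hV x n).1.le.trans (add_le_add (hB _) (hB _))
  have hterm : ∀ (k : V → ℕ) (n : ℕ), ∀ w, 0 ≤ (k w : ℝ) * logFrieze hV w n := fun k n w =>
    mul_nonneg (Nat.cast_nonneg _) (logFrieze_nonneg hV _ _)
  have hsingle : ∀ (k : V → ℕ) (n : ℕ), 0 < k y →
      logFrieze hV y n ≤ ∑ w, (k w : ℝ) * logFrieze hV w n := fun k n hk =>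
    (le_mul_of_one_le_left (logFrieze_nonneg hV _ _) (by exact_mod_cast hk)).trans
      (Finset.single_le_sum (f := fun w => (k w : ℝ) * logFrieze hV w n)
        (fun w _ => hterm k n w) (Finset.mem_univ y))
  have hsum : ∀ (k : V → ℕ) (n : ℕ), 0 ≤ ∑ w, (k w : ℝ) * logFrieze hV w n := fun k n =>
    Finset.sum_nonneg fun w _ => hterm k n w
  refine ⟨B + B, fun n => ?_⟩
  rcases Nat.eq_zero_or_pos (Fintype.card (x ⟶ y)) with h | h
  · have h' : 0 < Fintype.card (y ⟶ x) := by unfold edgeMult at hxy; omega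
    cases n with
    | zero =>
      rw [logFrieze_zero]
      have := (logFrieze_nonneg hV x 0).trans (hB 0)
      linarith
    | succ n =>
      refine le_trans ?_ (hle n)
      exact (hsingle (fun w => Fintype.card (w ⟶ x)) (n + 1) h').trans
        (le_add_of_nonneg_right (hsum (fun w => Fintype.card (x ⟶ w)) n))
  · refine le_trans ?_ (hle n)
    exact (hsingle (fun w => Fintype.card (x ⟶ w)) n h).trans
      (le_add_of_nonneg_left (hsum (fun w => Fintype.card (w ⟶ x)) (n + 1)))

theorem forall_isBoundedSeq_or (hV : IsAcyclic V) (hconn : IsConnectedMult (edgeMult V)) :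
    (∀ x, IsBoundedSeq (frieze hV x)) ∨ ∀ x, ¬ IsBoundedSeq (frieze hV x) := by
  by_cases h : ∃ x, IsBoundedSeq (frieze hV x)
  · exact Or.inl (Set.eq_univ_iff_forall.1 (hconn {x | IsBoundedSeq (frieze hV x)} h
      fun x hx y hxy => isBoundedSeq_of_edge hV hx hxy))
  · exact Or.inr (not_exists.1 h)

/-- If infinitely many rows lie below a common bound then, by integrality, two of them coincide. -/
theorem exists_row_eq (hV : IsAcyclic V) {B : ℝ}
    (h : {n | ∀ x, logFrieze hV x n ≤ B}.Infinite) :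
    ∃ a b, a < b ∧ ∀ x, frieze hV x a = frieze hV x b := by
  classical
  obtain ⟨K, hK⟩ := exists_int_gt (Real.exp B)
  have hmaps : Set.MapsTo (fun n x => (frieze hV x n).num) {n | ∀ x, logFrieze hV x n ≤ B}
      (Set.Icc (0 : V → ℤ) (fun _ => K)) := by
    refine fun n hn => ⟨fun x => (Rat.num_pos.2 (frieze_pos hV x n)).le, fun x => ?_⟩
    have hpos : (0 : ℝ) < frieze hV x n := by exact_mod_cast frieze_pos hV x n
    have h1 : (frieze hV x n : ℝ) ≤ K :=
      ((Real.log_le_iff_le_exp hpos).1 (hn x)).trans hK.le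
    rw [← frieze_num] at h1
    exact_mod_cast h1
  obtain ⟨a, -, b, -, hab, heq⟩ := h.exists_lt_map_eq_of_mapsTo hmaps (Set.finite_Icc _ _)
  refine ⟨a, b, hab, fun x => ?_⟩
  rw [← frieze_num, ← frieze_num hV x b, congrFun heq x]

theorem isBoundedSeq_of_row_eq (hV : IsAcyclic V) {a b : ℕ} (hab : a < b)
    (h : ∀ x, frieze hV x a = frieze hV x b) (x : V) : IsBoundedSeq (frieze hV x) := by
  refine ⟨∑ i ∈ Finset.range b, |frieze hV x i|, fun n => ?_⟩
  induction n using Nat.strong_induction_on with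
  | _ n ih =>
    rcases Nat.lt_or_ge n b with hn | hn
    · exact Finset.single_le_sum (f := fun i => |frieze hV x i|) (fun _ _ => abs_nonneg _)
        (Finset.mem_range.2 hn)
    · have := frieze_add_eq hV h (n - b) x
      rw [Nat.add_sub_cancel' hn] at this
      rw [← this]
      exact ih _ (by omega)

/-- Summed over times, the arrows in both directions combine to the edge multiplicities, up to a boundary
term from the shift by one at the arrows ending at `x`. -/
theorem sum_logNeighbours (hV : IsAcyclic V) (x : V) (a p : ℕ) :
    ∑ n ∈ Finset.range p, logNeighbours hV x (a + n) =
      ∑ w, (edgeMult V x w : ℝ) * (∑ n ∈ Finset.range p, logFrieze hV w (a + n)) +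
        ∑ w, (Fintype.card (w ⟶ x) : ℝ) * (logFrieze hV w (a + p) - logFrieze hV w a) := by
  have hshift : ∀ w, ∑ n ∈ Finset.range p, logFrieze hV w (a + n + 1) =
      ∑ n ∈ Finset.range p, logFrieze hV w (a + n) +
        (logFrieze hV w (a + p) - logFrieze hV w a) := by
    intro w
    have := Finset.sum_range_sub (fun n => logFrieze hV w (a + n)) p
    rw [Finset.sum_sub_distrib] at this
    simp only [add_zero, ← add_assoc] at this
    linarith
  simp only [logNeighbours, Finset.sum_add_distrib]
  rw [Finset.sum_comm, Finset.sum_comm (s := Finset.range p)]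
  simp only [← Finset.mul_sum, hshift, ← Finset.sum_add_distrib]
  refine Finset.sum_congr rfl fun w _ => ?_
  rw [edgeMult]
  push_cast
  ring

theorem sum_logFrieze_add (hV : IsAcyclic V) (x : V) (a p : ℕ) :
    ∑ n ∈ Finset.range p, (logFrieze hV x (a + n + 1) + logFrieze hV x (a + n)) =
      2 * ∑ n ∈ Finset.range p, logFrieze hV x (a + n) +
        (logFrieze hV x (a + p) - logFrieze hV x a) := by
  have := Finset.sum_range_sub (fun n => logFrieze hV x (a + n)) p
  rw [Finset.sum_sub_distrib] at this
  simp only [add_zero, ← add_assoc] at this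
  rw [Finset.sum_add_distrib]
  linarith

/-- Summing the logarithms over a period of a bounded frieze gives a strictly subadditive function. -/
theorem isDynkin_of_bounded [Nonempty V] (hV : IsAcyclic V)
    (hconn : IsConnectedMult (edgeMult V)) (hb : ∀ x, IsBoundedSeq (frieze hV x)) :
    IsDynkin (edgeMult V) := by
  obtain ⟨B, hB⟩ : ∃ B, ∀ x n, logFrieze hV x n ≤ B := by
    choose B hB using fun x => (isBoundedSeq_frieze_iff hV x).1 (hb x)
    obtain ⟨C, hC⟩ := (Set.finite_range B).bddAbove
    exact ⟨C, fun x n => (hB x n).trans (hC ⟨x, rfl⟩)⟩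
  obtain ⟨a, b, hab, hrow⟩ := exists_row_eq hV (B := B) (by
    simpa [hB] using Set.infinite_univ (α := ℕ))
  obtain ⟨p, rfl⟩ := Nat.exists_eq_add_of_lt hab
  have hper : ∀ x, logFrieze hV x (a + (p + 1)) = logFrieze hV x a := fun x => by
    rw [logFrieze, logFrieze, hrow, add_assoc]
  have hnonneg : ∀ x, 0 ≤ ∑ n ∈ Finset.range (p + 1), logFrieze hV x (a + n) := fun x =>
    Finset.sum_nonneg fun n _ => logFrieze_nonneg hV _ _
  have hstrict : ∀ x, ∑ w, (edgeMult V x w : ℝ) *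
      (∑ n ∈ Finset.range (p + 1), logFrieze hV w (a + n)) <
        2 * ∑ n ∈ Finset.range (p + 1), logFrieze hV x (a + n) := by
    intro x
    have h1 := sum_logNeighbours hV x a (p + 1)
    have h2 := sum_logFrieze_add hV x a (p + 1)
    simp only [hper, sub_self, mul_zero, Finset.sum_const_zero, add_zero] at h1 h2
    rw [← h1, ← h2]
    exact Finset.sum_lt_sum_of_nonempty (by simp) fun n _ => (logFrieze_add_bounds hV x (a + n)).1
  refine isDynkin_of_strictly_subadditive edgeMult_comm (edgeMult_self hV) hconn (fun x => ?_)
    hstrict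
  have h0 : 0 ≤ ∑ w, (edgeMult V x w : ℝ) *
      (∑ n ∈ Finset.range (p + 1), logFrieze hV w (a + n)) :=
    Finset.sum_nonneg fun w _ => mul_nonneg (Nat.cast_nonneg _) (hnonneg w)
  linarith [hstrict x]

end Friezes
/-! ### Growth of rational sequences and limits of almost additive functions -/

section Growth

/-- A sequence satisfying a linear recursion grows at most exponentially. -/
theorem IsRationalSeq.exists_le_exp {a : ℕ → ℚ} (ha : IsRationalSeq a) :
    ∃ K B : ℝ, 1 ≤ K ∧ 1 ≤ B ∧ ∀ n, |(a n : ℝ)| ≤ K * B ^ n := by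
  obtain ⟨E, hE⟩ := ha
  set B : ℝ := 1 + ∑ i, ‖E.coeffs i‖ with hB
  have hB1 : 1 ≤ B := le_add_of_nonneg_right (Finset.sum_nonneg fun _ _ => norm_nonneg _)
  set K : ℝ := 1 + ∑ i ∈ Finset.range E.order, ‖(a i : ℂ)‖ with hK
  have hK1 : 1 ≤ K := le_add_of_nonneg_right (Finset.sum_nonneg fun _ _ => norm_nonneg _)
  refine ⟨K, B, hK1, hB1, fun n => ?_⟩
  have hnorm : ∀ n, |(a n : ℝ)| = ‖(a n : ℂ)‖ := fun n => by
    rw [← Complex.ofReal_ratCast, Complex.norm_real, Real.norm_eq_abs]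
  rw [hnorm]
  induction n using Nat.strong_induction_on with
  | _ n ih =>
  rcases Nat.lt_or_ge n E.order with hn | hn
  · have h1 : ‖(a n : ℂ)‖ ≤ K := by
      have := Finset.single_le_sum (f := fun i => ‖(a i : ℂ)‖) (fun _ _ => norm_nonneg _)
        (Finset.mem_range.2 hn)
      linarith
    exact h1.trans (le_mul_of_one_le_right (by linarith) (one_le_pow₀ hB1))
  · rcases Nat.eq_zero_or_pos n with rfl | hn0
    · have h0 := hE 0
      obtain hord : E.order = 0 := Nat.le_zero.1 hn
      have : IsEmpty (Fin E.order) := by rw [hord]; infer_instance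
      simp only [Finset.univ_eq_empty, Finset.sum_empty, hord] at h0
      rw [h0, norm_zero]
      positivity
    have h1 := hE (n - E.order)
    dsimp only at h1
    rw [Nat.sub_add_cancel hn] at h1
    rw [h1]
    calc ‖∑ i, E.coeffs i * (a (n - E.order + i) : ℂ)‖
        ≤ ∑ i, ‖E.coeffs i‖ * (K * B ^ (n - 1)) := by
          refine norm_sum_le_of_le _ fun i _ => ?_
          rw [norm_mul]
          refine mul_le_mul_of_nonneg_left ?_ (norm_nonneg _)
          have hi := i.2
          refine (ih _ (by omega)).trans (mul_le_mul_of_nonneg_left ?_ (by linarith))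
          exact pow_le_pow_right₀ hB1 (by omega)
      _ = (∑ i, ‖E.coeffs i‖) * (K * B ^ (n - 1)) := by rw [Finset.sum_mul]
      _ ≤ B * (K * B ^ (n - 1)) := by
          refine mul_le_mul_of_nonneg_right (by linarith) ?_
          have : 0 ≤ K := by linarith
          have : 0 ≤ B := by linarith
          positivity
      _ = K * B ^ n := by
          conv_rhs => rw [← Nat.sub_add_cancel hn0, pow_succ]
          ring

open Filter Topology in
/-- If `X` tends to infinity but grows at most linearly, then at some time `N` both `N` and `X N` are small
compared with the sum of the earlier terms: otherwise that sum, and with it `X`, would grow exponentially. -/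
theorem exists_small_increment {X : ℕ → ℝ} (hX0 : ∀ n, 0 ≤ X n) (hX : Tendsto X atTop atTop)
    {α β : ℝ} (hlin : ∀ n, X n ≤ α * n + β) {ε : ℝ} (hε : 0 < ε) :
    ∃ N : ℕ, 0 < ∑ n ∈ Finset.range N, X n ∧ (N : ℝ) ≤ ε * ∑ n ∈ Finset.range N, X n ∧
      X N ≤ ε * ∑ n ∈ Finset.range N, X n := by
  set S : ℕ → ℝ := fun N => ∑ n ∈ Finset.range N, X n with hS
  have hS0 : ∀ N, 0 ≤ S N := fun N => Finset.sum_nonneg fun _ _ => hX0 _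
  obtain ⟨n₀, hn₀⟩ := eventually_atTop.1 (hX.eventually_ge_atTop (2 / ε))
  have hlow : ∀ k : ℕ, k * (2 / ε) ≤ S (n₀ + k) := by
    intro k
    induction k with
    | zero => simpa using hS0 n₀
    | succ k ih =>
      have h1 : S (n₀ + (k + 1)) = S (n₀ + k) + X (n₀ + k) := Finset.sum_range_succ _ _
      rw [h1]
      push_cast
      linarith [hn₀ (n₀ + k) (by omega)]
  have hN : ∀ k : ℕ, n₀ + 1 ≤ k → 0 < S (n₀ + k) ∧ ((n₀ + k : ℕ) : ℝ) ≤ ε * S (n₀ + k) := by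
    intro k hk
    have hk0 : (0 : ℝ) < k := by exact_mod_cast (by omega : 0 < k)
    have hkn : (n₀ : ℝ) ≤ k := by exact_mod_cast (by omega : n₀ ≤ k)
    refine ⟨lt_of_lt_of_le (by positivity) (hlow k), ?_⟩
    have h1 := mul_le_mul_of_nonneg_left (hlow k) hε.le
    rw [show ε * (k * (2 / ε)) = 2 * k by field_simp] at h1
    push_cast
    linarith
  by_contra! hcon
  set N₁ := n₀ + (n₀ + 1) with hN₁
  have hpos := (hN (n₀ + 1) le_rfl).1
  have hbig : ∀ k : ℕ, ε * S (N₁ + k) < X (N₁ + k) := fun k => by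
    have h1 := hN (n₀ + 1 + k) (by omega)
    rw [← add_assoc] at h1
    exact hcon _ h1.1 h1.2
  have hexp : ∀ k : ℕ, (1 + ε) ^ k * S N₁ ≤ S (N₁ + k) := by
    intro k
    induction k with
    | zero => simp
    | succ k ih =>
      have h1 : S (N₁ + (k + 1)) = S (N₁ + k) + X (N₁ + k) := Finset.sum_range_succ _ _
      have h2 := mul_le_mul_of_nonneg_left ih (by linarith : 0 ≤ 1 + ε)
      rw [h1, pow_succ]
      linarith [hbig k]
  have hlim : Tendsto (fun k : ℕ => α * ((k : ℝ) ^ 1 / (1 + ε) ^ k) +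
      (α * N₁ + β) * ((k : ℝ) ^ 0 / (1 + ε) ^ k)) atTop (𝓝 (α * 0 + (α * N₁ + β) * 0)) :=
    ((tendsto_pow_const_div_const_pow_of_one_lt 1 (by linarith)).const_mul α).add
      ((tendsto_pow_const_div_const_pow_of_one_lt 0 (by linarith)).const_mul _)
  rw [mul_zero, mul_zero, add_zero] at hlim
  obtain ⟨k, hk⟩ := (hlim.eventually_lt_const (mul_pos hε hpos)).exists
  have hp : 0 < (1 + ε) ^ k := by positivity
  have h1 : α * ((k : ℝ) ^ 1 / (1 + ε) ^ k) + (α * N₁ + β) * ((k : ℝ) ^ 0 / (1 + ε) ^ k) =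
      (α * (N₁ + k : ℕ) + β) / (1 + ε) ^ k := by
    push_cast
    field_simp
    ring
  rw [h1, div_lt_iff₀ hp] at hk
  have h2 := mul_le_mul_of_nonneg_left (hexp k) hε.le
  have h3 := hlin (N₁ + k)
  have h4 := hbig k
  linarith

variable {V : Type*} [Fintype V] [Nonempty V] {m : V → V → ℕ}

/-- On a connected multigraph with approximately additive points of the simplex, there is a positive
additive function: the additivity defect attains its minimum on the compact simplex. -/
theorem exists_additive_of_approx (hsym : ∀ u v, m u v = m v u) (hconn : IsConnectedMult m)
    {C : ℝ} (h : ∀ ε > 0, ∃ y ∈ stdSimplex ℝ V, ∀ v, |∑ w, (m v w : ℝ) * y w - 2 * y v| ≤ C * ε) :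
    ∃ f : V → ℝ, (∀ v, 0 < f v) ∧ ∀ v, ∑ w, (m v w : ℝ) * f w = 2 * f v := by
  classical
  obtain ⟨f, hf, hmin⟩ := (isCompact_stdSimplex ℝ V).exists_isMinOn
    ⟨_, single_mem_stdSimplex ℝ (Classical.arbitrary V)⟩
    (f := fun y => ∑ v, |∑ w, (m v w : ℝ) * y w - 2 * y v|) (by fun_prop)
  have hle : ∀ ε > 0, ∑ v, |∑ w, (m v w : ℝ) * f w - 2 * f v| ≤ (Fintype.card V * C) * ε := by
    intro ε hε
    obtain ⟨y, hy, hyb⟩ := h ε hε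
    refine (isMinOn_iff.1 hmin y hy).trans ?_
    refine (Finset.sum_le_card_nsmul _ _ _ fun v _ => hyb v).trans_eq ?_
    rw [Finset.card_univ, nsmul_eq_mul, mul_assoc]
  have hzero : ∑ v, |∑ w, (m v w : ℝ) * f w - 2 * f v| ≤ 0 := by
    refine le_of_forall_pos_le_add fun η hη => ?_
    have hD : 0 < |Fintype.card V * C| + 1 := by positivity
    refine (hle (η / (|Fintype.card V * C| + 1)) (by positivity)).trans ?_
    rw [zero_add, mul_div_assoc', div_le_iff₀ hD]
    nlinarith [le_abs_self (Fintype.card V * C)]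
  have hadd : ∀ v, ∑ w, (m v w : ℝ) * f w = 2 * f v := fun v => by
    have := (Finset.sum_eq_zero_iff_of_nonneg fun v _ => abs_nonneg _).1
      (le_antisymm hzero (Finset.sum_nonneg fun v _ => abs_nonneg _)) v (Finset.mem_univ v)
    exact sub_eq_zero.1 (abs_eq_zero.1 this)
  refine ⟨f, fun v => ?_, hadd⟩
  have huniv := hconn {v | 0 < f v} ?_ ?_
  · exact Set.eq_univ_iff_forall.1 huniv v
  · by_contra hne
    have : ∀ v, f v = 0 := fun v => le_antisymm
      (not_lt.1 fun h => hne ⟨v, h⟩) (hf.1 v)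
    have h1 := hf.2
    simp [this] at h1
  · intro v hv w hvw
    have h1 : (m w v : ℝ) * f v ≤ 2 * f w := by
      rw [← hadd w]
      exact Finset.single_le_sum (f := fun u => (m w u : ℝ) * f u)
        (fun u _ => mul_nonneg (Nat.cast_nonneg _) (hf.1 u)) (Finset.mem_univ v)
    have h2 : 0 < (m w v : ℝ) * f v := mul_pos (by rw [hsym]; exact_mod_cast hvw) hv
    change 0 < f w
    linarith

end Growth

/-! ### Unbounded rational friezes -/

section Unbounded

universe u v

variable {V : Type u} [Quiver.{v} V] [∀ x y : V, Fintype (x ⟶ y)] [Fintype V]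

open Filter in
theorem tendsto_sum_logFrieze (hV : IsAcyclic V) {x₀ : V}
    (hx : ¬ IsBoundedSeq (frieze hV x₀)) :
    Tendsto (fun n => ∑ x, logFrieze hV x n) atTop atTop := by
  refine tendsto_atTop.2 fun B => ?_
  rw [← Nat.cofinite_eq_atTop, eventually_cofinite]
  by_contra hinf
  have hsub : {n | ¬ B ≤ ∑ x, logFrieze hV x n} ⊆ {n | ∀ x, logFrieze hV x n ≤ B} := fun n hn x =>
    (Finset.single_le_sum (f := fun x => logFrieze hV x n)
      (fun x _ => logFrieze_nonneg hV x n) (Finset.mem_univ x)).trans (not_le.1 hn).le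
  obtain ⟨a, b, hab, h⟩ := exists_row_eq hV (Set.Infinite.mono hsub hinf)
  exact hx (isBoundedSeq_of_row_eq hV hab h x₀)

theorem sum_logFrieze_le_linear (hV : IsAcyclic V)
    (hr : ∀ x, IsRationalSeq (frieze hV x)) :
    ∃ α β : ℝ, ∀ n : ℕ, ∑ x, logFrieze hV x n ≤ α * n + β := by
  choose K B hK hB h using fun x => (hr x).exists_le_exp
  refine ⟨∑ x, Real.log (B x), ∑ x, Real.log (K x), fun n => ?_⟩
  rw [Finset.sum_mul, ← Finset.sum_add_distrib]
  refine Finset.sum_le_sum fun x _ => ?_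
  have hKx : 0 < K x := by linarith [hK x]
  have hBx : 0 < B x := by linarith [hB x]
  have h1 : logFrieze hV x n ≤ Real.log (K x * B x ^ n) :=
    Real.log_le_log (by exact_mod_cast frieze_pos hV x n) ((le_abs_self _).trans (h x n))
  rw [Real.log_mul hKx.ne' (by positivity), Real.log_pow] at h1
  linarith

/-- The partial sums of the logarithms are additive up to an error linear in `N` and boundary terms. -/
theorem abs_additivity_defect_le (hV : IsAcyclic V) (x : V) (N : ℕ) :
    |∑ w, (edgeMult V x w : ℝ) * (∑ n ∈ Finset.range N, logFrieze hV w n) -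
      2 * ∑ n ∈ Finset.range N, logFrieze hV x n| ≤
    N * Real.log 2 + (1 + ∑ w, (Fintype.card (w ⟶ x) : ℝ)) * ∑ w, logFrieze hV w N := by
  have h1 := sum_logNeighbours hV x 0 N
  have h2 := sum_logFrieze_add hV x 0 N
  have hlow : ∑ n ∈ Finset.range N, logNeighbours hV x n ≤
      ∑ n ∈ Finset.range N, (logFrieze hV x (n + 1) + logFrieze hV x n) :=
    Finset.sum_le_sum fun n _ => (logFrieze_add_bounds hV x n).1.le
  have hup : ∑ n ∈ Finset.range N, (logFrieze hV x (n + 1) + logFrieze hV x n) ≤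
      ∑ n ∈ Finset.range N, logNeighbours hV x n + N * Real.log 2 := by
    refine (Finset.sum_le_sum fun n _ => (logFrieze_add_bounds hV x n).2).trans_eq ?_
    rw [Finset.sum_add_distrib, Finset.sum_const, Finset.card_range, nsmul_eq_mul]
  simp only [zero_add, logFrieze_zero, sub_zero] at h1 h2
  have hsingle : ∀ w, logFrieze hV w N ≤ ∑ w, logFrieze hV w N := fun w =>
    Finset.single_le_sum (f := fun x => logFrieze hV x N)
      (fun x _ => logFrieze_nonneg hV x N) (Finset.mem_univ w)
  have h3 : ∑ w, (Fintype.card (w ⟶ x) : ℝ) * logFrieze hV w N ≤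
      (∑ w, (Fintype.card (w ⟶ x) : ℝ)) * ∑ w, logFrieze hV w N := by
    rw [Finset.sum_mul]
    exact Finset.sum_le_sum fun w _ => mul_le_mul_of_nonneg_left (hsingle w) (Nat.cast_nonneg _)
  have h4 : 0 ≤ ∑ w, (Fintype.card (w ⟶ x) : ℝ) * logFrieze hV w N :=
    Finset.sum_nonneg fun w _ => mul_nonneg (Nat.cast_nonneg _) (logFrieze_nonneg hV w N)
  have h5 := logFrieze_nonneg hV x N
  have h6 : 0 ≤ N * Real.log 2 := mul_nonneg (Nat.cast_nonneg _) (Real.log_nonneg one_le_two)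
  rw [abs_le, one_add_mul]
  constructor <;> linarith [hsingle x]

theorem isExtendedDynkin_of_unbounded [Nonempty V] (hV : IsAcyclic V)
    (hconn : IsConnectedMult (edgeMult V)) (hr : ∀ x, IsRationalSeq (frieze hV x))
    (hub : ∀ x, ¬ IsBoundedSeq (frieze hV x)) : IsExtendedDynkin (edgeMult V) := by
  obtain ⟨α, β, hlin⟩ := sum_logFrieze_le_linear hV hr
  set D : ℝ := 1 + ∑ x : V, ∑ w : V, (Fintype.card (w ⟶ x) : ℝ) with hD
  obtain ⟨f, hf, hadd⟩ := exists_additive_of_approx edgeMult_comm hconn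
    (C := Real.log 2 + D) fun ε hε => by
      obtain ⟨N, hpos, hN, hX⟩ := exists_small_increment
        (fun n => Finset.sum_nonneg fun x _ => logFrieze_nonneg hV x n)
        (tendsto_sum_logFrieze hV (hub (Classical.arbitrary V))) hlin hε
      set S := ∑ n ∈ Finset.range N, ∑ x, logFrieze hV x n with hS
      refine ⟨fun x => (∑ n ∈ Finset.range N, logFrieze hV x n) / S, ⟨fun x => ?_, ?_⟩, fun x => ?_⟩
      · exact div_nonneg (Finset.sum_nonneg fun n _ => logFrieze_nonneg hV x n) hpos.le
      · rw [← Finset.sum_div, Finset.sum_comm, div_self hpos.ne']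
      · have hdefect := abs_additivity_defect_le hV x N
        have hDx : 1 + ∑ w : V, (Fintype.card (w ⟶ x) : ℝ) ≤ D := by
          have := Finset.single_le_sum (f := fun x : V => ∑ w : V, (Fintype.card (w ⟶ x) : ℝ))
            (fun x _ => Finset.sum_nonneg fun w _ => Nat.cast_nonneg _) (Finset.mem_univ x)
          linarith
        have hX0 : 0 ≤ ∑ w, logFrieze hV w N := Finset.sum_nonneg fun w _ => logFrieze_nonneg hV w N
        have hD0 : 0 ≤ D := by positivity
        have h1 := mul_le_mul_of_nonneg_right hDx hX0
        have h2 := mul_le_mul_of_nonneg_left hX hD0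
        have h3 := mul_le_mul_of_nonneg_right hN (Real.log_nonneg one_le_two)
        simp only [mul_div_assoc', ← Finset.sum_div, ← sub_div]
        rw [abs_div, abs_of_pos hpos, div_le_iff₀ hpos]
        linarith
  exact isExtendedDynkin_of_additive edgeMult_comm (edgeMult_self hV) hconn hf hadd

end Unbounded
end FriezeDynkin

theorem theorem10 {V : Type*} [Quiver V] [Fintype V] [∀ x y : V, Fintype (x ⟶ y)]
    (hV : FriezeDynkin.IsAcyclic V)
    (hconn : (FriezeDynkin.underlyingGraph V).Connected) :
    ((∀ x : V, FriezeDynkin.IsBoundedSeq (FriezeDynkin.frieze hV x)) ∨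
      (∀ x : V, ¬ FriezeDynkin.IsBoundedSeq (FriezeDynkin.frieze hV x))) ∧
    ((∀ x : V, FriezeDynkin.IsRationalSeq (FriezeDynkin.frieze hV x)) →
      ((∀ x : V, FriezeDynkin.IsBoundedSeq (FriezeDynkin.frieze hV x)) →
        FriezeDynkin.IsDynkin (FriezeDynkin.edgeMult V)) ∧
      ((∀ x : V, ¬ FriezeDynkin.IsBoundedSeq (FriezeDynkin.frieze hV x)) →
        FriezeDynkin.IsExtendedDynkin (FriezeDynkin.edgeMult V))) := by
  have hne : Nonempty V := hconn.nonempty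
  have hconn' := FriezeDynkin.isConnectedMult_edgeMult hconn
  exact ⟨FriezeDynkin.forall_isBoundedSeq_or hV hconn', fun hr =>
    ⟨fun hb => FriezeDynkin.isDynkin_of_bounded hV hconn' hb,
      fun hub => FriezeDynkin.isExtendedDynkin_of_unbounded hV hconn' hr hub⟩⟩
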